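/- **Conventions.** A *locally $C^*$-algebra* is a complete Hausdorff complex topological $*$-algebra $A$ in which a net converges to $0$ if and only if $p$ of it converges to $0$ for every $p\in S(A)$, the set of continuous $C^*$-seminorms on $A$; its morphisms are the continuous $*$-homomorphisms. A *Hilbert $A$-module* is a right $A$-module $E$ with an $A$-valued inner product (linear in the second variable, Hermitian, positive and definite) that is complete for the topology of the seminorms $\bar p_E(\xi)=p(\langle\xi,\xi\rangle)^{1/2}$, $p\in S(A)$. It is *full* if $\operatorname{span}\{\langle\xi,\eta\rangle\}$ is dense in $A$. For Hilbert $A$-modules $E,F$, let $L(E,F)$ be the space of adjointable module morphisms $E\to F$, with the topology of the seminorms $\tilde p(T)=\sup\{\bar p_F(T\xi):\bar p_E(\xi)\le 1\}$, $p\in S(A)$; let $\theta_{\eta,\xi}(\zeta)=\eta\langle\xi,\zeta\rangle$ for $\eta\in F$, $\xi\in E$, let $K(E,F)$ be the closure in $L(E,F)$ of the span of these operators, and $K(E)=K(E,E)$. The algebra $A$ is regarded as a Hilbert $A$-module with $\langle a,b\rangle=a^*b$. A map $u:E\to F$ from a Hilbert $A$-module to a Hilbert $B$-module is a *morphism of Hilbert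 modules* if there is a morphism of locally $C^*$-algebras $\alpha:A\to B$ with $\langle u\xi,u\eta\rangle=\alpha(\langle\xi,\eta\rangle)$ for all $\xi,\eta\in E$. An *action* of a locally compact group $G$ on $E$ is a group homomorphism $g\mapsto u_g$ from $G$ into the group $\operatorname{Aut}(E)$ of bijections $u$ of $E$ such that $u$ and $u^{-1}$ are morphisms of Hilbert modules; an action of $G$ on $A$ is a group homomorphism from $G$ into the group of automorphisms of the locally $C^*$-algebra $A$. The action $u$ is *continuous* if $g\mapsto u_g(\xi)$ is continuous for every $\xi\in E$, and an *inverse limit action* if $E$ (with $A$) can be written as the inverse limit, over a directed set, of Hilbert $C^*$-modules $E_\lambda$ (over $C^*$-algebras $A_\lambda$) so that $u_g=\varprojlim_\lambda u_g^\lambda$ for all $g\in G$, for some actions $u^\lambda$ of $G$ on $E_\lambda$. **Proposition.** Let $G$ be a locally compact group and let $g\mapsto u_g$ be an action of $G$ on a full Hilbert $A$-module $E$ over a locally $C^*$-algebra $A$. Let $g\mapsto\alpha^u_g$ be the action of $G$ on $A$ induced by $u$, that is, the unique action with $\alpha^u_g(\langle\xi,\eta\rangle)=\langle u_g(\xi),u_g(\eta)\rangle$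 for all $g\in G$, $\xi,\eta\in E$ (it exists). Then $K(E)$, with composition and adjoint, is a locally $C^*$-algebra, and $\widetilde E=K(E,A)$ is a Hilbert $K(E)$-module with the right action $T\cdot k=T\circ k$ and the inner product $\langle S,T\rangle=S^*\circ T$; and there is a unique action $g\mapsto\widetilde u_g$ of $G$ on the Hilbert $K(E)$-module $\widetilde E$ such that $$\widetilde u_g(\theta_{a,\xi})=\theta_{\alpha^u_g(a),\,u_g(\xi)}\qquad(g\in G,\ a\in A,\ \xi\in E).$$ Moreover, if $u$ is a continuous inverse limit action, then $\widetilde u$ is a continuous inverse limit action. -/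

import Mathlib

open Filter Topology UniformSpace
open scoped RightActions

noncomputable section

/-- A C⋆-seminorm on a complex ⋆-algebra. -/
structure CStarSeminorm (A : Type*) [NonUnitalRing A] [StarRing A] [Module ℂ A]
    extends Seminorm ℂ A where
  mul_le : ∀ a b : A, toFun (a * b) ≤ toFun a * toFun b
  star_mul_self : ∀ a : A, toFun (star a * a) = toFun a ^ 2

namespace CStarSeminorm

variable {A : Type*} [NonUnitalRing A] [StarRing A] [Module ℂ A]

instance : CoeFun (CStarSeminorm A) (fun _ => A → ℝ) := ⟨fun p => p.toSeminorm⟩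

theorem mul_le' (p : CStarSeminorm A) (a b : A) : p (a * b) ≤ p a * p b := p.mul_le a b

theorem star_mul_self' (p : CStarSeminorm A) (a : A) : p (star a * a) = p a ^ 2 :=
  p.star_mul_self a

theorem nonneg (p : CStarSeminorm A) (a : A) : 0 ≤ p a := apply_nonneg p.toSeminorm a

theorem le_star (p : CStarSeminorm A) (a : A) : p a ≤ p (star a) := by
  have h1 := p.mul_le' (star a) a
  rw [p.star_mul_self'] at h1
  by_contra h
  push Not at h
  nlinarith [p.nonneg (star a), p.nonneg a]

theorem star_eq (p : CStarSeminorm A) (a : A) : p (star a) = p a :=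
  le_antisymm (by simpa using p.le_star (star a)) (p.le_star a)

/-- The algebra `A`, equipped with the C⋆-seminorm `p`. -/
def WithSeminorm (_ : CStarSeminorm A) : Type _ := A

variable (p : CStarSeminorm A)

instance : NonUnitalRing p.WithSeminorm := inferInstanceAs (NonUnitalRing A)
instance : StarRing p.WithSeminorm := inferInstanceAs (StarRing A)

instance : Module ℂ p.WithSeminorm := inferInstanceAs (Module ℂ A)

instance : SeminormedAddCommGroup p.WithSeminorm :=
  AddGroupSeminorm.toSeminormedAddCommGroup (E := p.WithSeminorm) p.toSeminorm.toAddGroupSeminorm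

instance : NonUnitalSeminormedRing p.WithSeminorm where
  __ := (inferInstance : NonUnitalRing p.WithSeminorm)
  __ := (inferInstance : SeminormedAddCommGroup p.WithSeminorm)
  norm_mul_le a b := p.mul_le a b

instance : NormedSpace ℂ p.WithSeminorm where
  norm_smul_le c a := (map_smul_eq_mul p.toSeminorm c a).le

instance [StarModule ℂ A] : StarModule ℂ p.WithSeminorm := inferInstanceAs (StarModule ℂ A)
instance [IsScalarTower ℂ A A] : IsScalarTower ℂ p.WithSeminorm p.WithSeminorm :=
  inferInstanceAs (IsScalarTower ℂ A A)
instance [SMulCommClass ℂ A A] : SMulCommClass ℂ p.WithSeminorm p.WithSeminorm :=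
  inferInstanceAs (SMulCommClass ℂ A A)

theorem norm_withSeminorm (a : p.WithSeminorm) : ‖a‖ = p a := rfl

instance : NormedStarGroup p.WithSeminorm where
  norm_star_le a := (p.star_eq a).le

/-- The Hausdorff completion of `A` with respect to `p`. -/
abbrev Compl : Type _ := Completion p.WithSeminorm

instance : Mul p.Compl :=
  ⟨Function.curry <| (Completion.isDenseInducing_coe.prodMap
    Completion.isDenseInducing_coe).extend ((↑) ∘ Function.uncurry (· * ·))⟩

theorem coe_mul_compl (a b : p.WithSeminorm) : ((a * b : p.WithSeminorm) : p.Compl) = a * b :=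
  ((Completion.isDenseInducing_coe.prodMap Completion.isDenseInducing_coe).extend_eq
      ((Completion.continuous_coe _).comp (@continuous_mul p.WithSeminorm _ _ _)) (a, b)).symm

instance : ContinuousMul p.Compl where
  continuous_mul := by
    let m := (AddMonoidHom.mul : p.WithSeminorm →+ p.WithSeminorm →+ p.WithSeminorm).compr₂
      Completion.toCompl
    have : Continuous fun x : p.WithSeminorm × p.WithSeminorm => m x.1 x.2 :=
      (Completion.continuous_coe _).comp continuous_mul
    have di : IsDenseInducing (Completion.toCompl : p.WithSeminorm → p.Compl) :=
      Completion.isDenseInducing_coe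
    exact (di.extend_Z_bilin di this :)

instance : NonUnitalRing p.Compl where
  __ := (inferInstance : AddCommGroup p.Compl)
  __ := (inferInstance : Mul p.Compl)
  zero_mul a := Completion.induction_on a (isClosed_eq (by fun_prop) continuous_const)
    fun a => by rw [← Completion.coe_zero, ← coe_mul_compl, zero_mul]
  mul_zero a := Completion.induction_on a (isClosed_eq (by fun_prop) continuous_const)
    fun a => by rw [← Completion.coe_zero, ← coe_mul_compl, mul_zero]
  mul_assoc a b c := Completion.induction_on₃ a b c (isClosed_eq (by fun_prop) (by fun_prop))
    fun a b c => by simp only [← coe_mul_compl, mul_assoc]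
  left_distrib a b c := Completion.induction_on₃ a b c (isClosed_eq (by fun_prop) (by fun_prop))
    fun a b c => by simp only [← Completion.coe_add, ← coe_mul_compl, mul_add]
  right_distrib a b c := Completion.induction_on₃ a b c (isClosed_eq (by fun_prop) (by fun_prop))
    fun a b c => by simp only [← Completion.coe_add, ← coe_mul_compl, add_mul]

instance : NonUnitalNormedRing p.Compl where
  __ := (inferInstance : NonUnitalRing p.Compl)
  __ := (inferInstance : NormedAddCommGroup p.Compl)
  norm_mul_le a b := Completion.induction_on₂ a b (isClosed_le (by fun_prop) (by fun_prop))
    fun a b => by simpa only [← coe_mul_compl, Completion.norm_coe] using norm_mul_le a b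

instance : Star p.Compl := ⟨Completion.map star⟩

theorem uniformContinuous_star : UniformContinuous (star : p.WithSeminorm → p.WithSeminorm) :=
  uniformContinuous_addMonoidHom_of_continuous
    (f := (starAddEquiv : p.WithSeminorm ≃+ p.WithSeminorm)) continuous_star

theorem coe_star_compl (a : p.WithSeminorm) :
    ((star a : p.WithSeminorm) : p.Compl) = star (a : p.Compl) :=
  (Completion.map_coe p.uniformContinuous_star a).symm

instance : ContinuousStar p.Compl := ⟨Completion.continuous_map⟩

instance : StarRing p.Compl where
  star_involutive a := Completion.induction_on a (isClosed_eq (by fun_prop) (by fun_prop))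
    fun a => by simp only [← coe_star_compl, star_star]
  star_mul a b := Completion.induction_on₂ a b (isClosed_eq (by fun_prop) (by fun_prop))
    fun a b => by simp only [← coe_star_compl, ← coe_mul_compl, star_mul]
  star_add a b := Completion.induction_on₂ a b (isClosed_eq (by fun_prop) (by fun_prop))
    fun a b => by simp only [← coe_star_compl, ← Completion.coe_add, star_add]

theorem smul_mul_compl [IsScalarTower ℂ A A] (c : ℂ) (a b : p.Compl) :
    c • a * b = c • (a * b) :=
  Completion.induction_on₂ a b
    (isClosed_eq ((continuous_fst.const_smul c).mul continuous_snd)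
      ((continuous_fst.mul continuous_snd).const_smul c))
    fun a b => by rw [← Completion.coe_smul, ← coe_mul_compl, ← coe_mul_compl,
      ← Completion.coe_smul, smul_mul_assoc]

theorem mul_smul_compl [SMulCommClass ℂ A A] (c : ℂ) (a b : p.Compl) :
    a * c • b = c • (a * b) :=
  Completion.induction_on₂ a b
    (isClosed_eq (continuous_fst.mul (continuous_snd.const_smul c))
      ((continuous_fst.mul continuous_snd).const_smul c))
    fun a b => by rw [← Completion.coe_smul, ← coe_mul_compl, ← coe_mul_compl,
      ← Completion.coe_smul, mul_smul_comm]

theorem star_smul_compl [StarModule ℂ A] (c : ℂ) (a : p.Compl) :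
    star (c • a) = star c • star a :=
  Completion.induction_on a
    (isClosed_eq (continuous_id.const_smul c).star (continuous_star.const_smul (star c)))
    fun a => by rw [← Completion.coe_smul, ← coe_star_compl, ← coe_star_compl,
      ← Completion.coe_smul, star_smul]

instance [IsScalarTower ℂ A A] [SMulCommClass ℂ A A] [StarModule ℂ A] :
    NonUnitalCStarAlgebra p.Compl where
  __ := (inferInstance : NonUnitalNormedRing p.Compl)
  __ := (inferInstance : StarRing p.Compl)
  __ := (inferInstance : NormedSpace ℂ p.Compl)
  __ := (inferInstance : CompleteSpace p.Compl)
  norm_mul_self_le a := Completion.induction_on a (isClosed_le (by fun_prop) (by fun_prop))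
    fun a => by
      simp only [← coe_star_compl, ← coe_mul_compl, Completion.norm_coe, norm_withSeminorm]
      exact (by rw [← sq]; exact (p.star_mul_self' a).ge)
  smul_assoc c a b := p.smul_mul_compl c a b
  smul_comm c a b := (p.mul_smul_compl c a b).symm
  star_smul c a := p.star_smul_compl c a

theorem le_add_of_star_mul_self [IsScalarTower ℂ A A] [SMulCommClass ℂ A A] [StarModule ℂ A]
    (a b : A) : p (star a * a) ≤ p (star a * a + star b * b) := by
  let _ := CStarAlgebra.spectralOrder p.Compl
  have := CStarAlgebra.spectralOrderedRing p.Compl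
  let x : p.WithSeminorm := a
  let y : p.WithSeminorm := b
  have h := CStarAlgebra.norm_le_norm_of_nonneg_of_le (star_mul_self_nonneg (x : p.Compl))
    (le_add_of_nonneg_right (star_mul_self_nonneg (y : p.Compl)))
  simp only [← coe_star_compl, ← coe_mul_compl, ← Completion.coe_add, Completion.norm_coe] at h
  exact h

end CStarSeminorm

/-- A continuous C⋆-seminorm; the elements of this type form the set `S(A)`. -/
structure ContCStarSeminorm (A : Type*) [NonUnitalRing A] [StarRing A] [Module ℂ A]
    [TopologicalSpace A] extends CStarSeminorm A where
  continuous_toFun : Continuous toFun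

/-- Locally C⋆-algebras: complete Hausdorff complex topological ⋆-algebras in which a net tends to
`0` iff `p` of it tends to `0` for every continuous C⋆-seminorm `p`. (Joint continuity of the
product and continuity of the involution follow from this.) -/
class IsLocallyCStarAlgebra (A : Type*) [NonUnitalRing A] [StarRing A] [Module ℂ A]
    [UniformSpace A] : Prop extends IsScalarTower ℂ A A, SMulCommClass ℂ A A, StarModule ℂ A,
    IsUniformAddGroup A, CompleteSpace A, T2Space A where
  nhds_zero : 𝓝 (0 : A) = ⨅ p : ContCStarSeminorm A, comap p.toCStarSeminorm (𝓝 0)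

/-- For a C⋆-seminorm `p` on `A`, the function `ξ ↦ p(⟨ξ, ξ⟩)^{1/2}` on an `A`-module with
`A`-valued inner product. -/
def modNorm {A E : Type*} [NonUnitalRing A] [StarRing A] [Module ℂ A] [Inner A E]
    (p : CStarSeminorm A) (ξ : E) : ℝ := √(p (inner A ξ ξ))

/-- Hilbert modules over `A`. The right action of `a` on `ξ` is written `ξ <• a`, and `inner A` is
linear in the second variable; an element of `A` is positive if it has the form `b⋆ b`. -/
class IsHilbertModule (A E : Type*) [NonUnitalRing A] [StarRing A] [Module ℂ A] [UniformSpace A]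
    [AddCommGroup E] [Module ℂ E] [SMul Aᵐᵒᵖ E] [Inner A E] [UniformSpace E] :
    Prop where
  isUniformAddGroup : IsUniformAddGroup E
  completeSpace : CompleteSpace E
  add_rsmul : ∀ (ξ η : E) (a : A), (ξ + η) <• a = ξ <• a + η <• a
  rsmul_add : ∀ (ξ : E) (a b : A), ξ <• (a + b) = ξ <• a + ξ <• b
  rsmul_mul : ∀ (ξ : E) (a b : A), ξ <• (a * b) = (ξ <• a) <• b
  smul_rsmul : ∀ (c : ℂ) (ξ : E) (a : A), (c • ξ) <• a = c • (ξ <• a)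
  rsmul_smul : ∀ (c : ℂ) (ξ : E) (a : A), ξ <• (c • a) = c • (ξ <• a)
  ip_add_right : ∀ ξ η ζ : E, inner A ξ (η + ζ) = inner A ξ η + inner A ξ ζ
  ip_smul_right : ∀ (c : ℂ) (ξ η : E), inner A ξ (c • η) = c • inner A ξ η
  inner_rsmul_right : ∀ (ξ η : E) (a : A), inner A ξ (η <• a) = inner A ξ η * a
  star_inner : ∀ ξ η : E, star (inner A ξ η) = inner A η ξ
  inner_self_pos : ∀ ξ : E, ∃ b : A, inner A ξ ξ = star b * b
  inner_self_eq_zero : ∀ ξ : E, inner A ξ ξ = 0 ↔ ξ = 0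
  nhds_zero : 𝓝 (0 : E) = ⨅ p : ContCStarSeminorm A, comap (modNorm p.toCStarSeminorm) (𝓝 0)

/-- A Hilbert `A`-module is full if the inner products span a dense subspace of `A`. -/
def IsFull (A E : Type*) [NonUnitalRing A] [Module ℂ A] [TopologicalSpace A] [Inner A E] : Prop :=
  Dense (Submodule.span ℂ {a : A | ∃ ξ η : E, a = inner A ξ η} : Set A)

namespace IsHilbertModule

variable {A E : Type*} [NonUnitalRing A] [StarRing A] [Module ℂ A] [UniformSpace A]
  [IsLocallyCStarAlgebra A]
  [AddCommGroup E] [Module ℂ E] [SMul Aᵐᵒᵖ E] [Inner A E] [UniformSpace E] [IsHilbertModule A E]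

theorem ip_add_left (ξ η ζ : E) : inner A (ξ + η) ζ = inner A ξ ζ + inner A η ζ := by
  rw [← star_inner, ip_add_right, star_add, star_inner, star_inner]

theorem ip_smul_left (c : ℂ) (ξ η : E) : inner A (c • ξ) η = star c • inner A ξ η := by
  rw [← star_inner, ip_smul_right, star_smul, star_inner]

theorem inner_rsmul_left (ξ η : E) (a : A) : inner A (ξ <• a) η = star a * inner A ξ η := by
  rw [← star_inner, inner_rsmul_right, star_mul, star_inner]

theorem ip_neg_right (ξ η : E) : inner A ξ (-η) = -inner A ξ η := by
  rw [← neg_one_smul ℂ, ip_smul_right, neg_one_smul]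

theorem ip_sub_right (ξ η ζ : E) : inner A ξ (η - ζ) = inner A ξ η - inner A ξ ζ := by
  rw [sub_eq_add_neg, ip_add_right, ip_neg_right, sub_eq_add_neg]

theorem ip_neg_left (ξ η : E) : inner A (-ξ) η = -inner A ξ η := by
  rw [← star_inner, ip_neg_right, star_neg, star_inner]

theorem ip_sub_left (ξ η ζ : E) : inner A (ξ - η) ζ = inner A ξ ζ - inner A η ζ := by
  rw [sub_eq_add_neg, ip_add_left, ip_neg_left, sub_eq_add_neg]

/-- The inner product separates points. -/
theorem ext_inner {ξ η : E} (h : ∀ ζ : E, inner A ζ ξ = inner A ζ η) : ξ = η := by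
  rw [← sub_eq_zero, ← inner_self_eq_zero (A := A), ip_sub_right, h, sub_self]

theorem modNorm_nonneg (p : CStarSeminorm A) (ξ : E) : 0 ≤ modNorm p ξ := Real.sqrt_nonneg _

theorem modNorm_sq (p : CStarSeminorm A) (ξ : E) : modNorm p ξ ^ 2 = p (inner A ξ ξ) :=
  Real.sq_sqrt (p.nonneg _)

theorem cauchy_schwarz_aux (p : CStarSeminorm A) (ξ η : E) (s : ℝ) (hs : 0 ≤ s) :
    2 * s * p (inner A ξ η) ^ 2 ≤
      p (inner A η η) + s ^ 2 * (p (inner A ξ ξ) * p (inner A ξ η) ^ 2) := by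
  set a := inner A ξ η with ha
  obtain ⟨c, hc⟩ := inner_self_pos (A := A) ((s : ℂ) • (ξ <• a) - η)
  have e : inner A η η + (s : ℂ) ^ 2 • (star a * (inner A ξ ξ * a))
      = star (((√(2 * s) : ℝ) : ℂ) • a) * (((√(2 * s) : ℝ) : ℂ) • a) + star c * c := by
    have h2 : ((√(2 * s) : ℝ) : ℂ) * ((√(2 * s) : ℝ) : ℂ) = 2 * s := by
      rw [← Complex.ofReal_mul, Real.mul_self_sqrt (by positivity)]; simp
    have h3 : inner A η ξ = star a := by rw [ha, star_inner]
    rw [← hc, star_smul, smul_mul_smul_comm, Complex.star_def, Complex.conj_ofReal, h2]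
    simp only [ip_sub_left, ip_sub_right, ip_smul_left, ip_smul_right,
      inner_rsmul_left, inner_rsmul_right, ← ha, h3, sub_mul, smul_mul_assoc, smul_sub,
      Complex.star_def, Complex.conj_ofReal, mul_assoc]
    rw [mul_smul, two_smul, sq, mul_smul]
    abel
  have h1 := p.le_add_of_star_mul_self (((√(2 * s) : ℝ) : ℂ) • a) c
  rw [← e, p.star_mul_self', map_smul_eq_mul, mul_pow] at h1
  have h4 : ‖((√(2 * s) : ℝ) : ℂ)‖ ^ 2 = 2 * s := by
    rw [Complex.norm_real, Real.norm_eq_abs, sq_abs, Real.sq_sqrt (by positivity)]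
  rw [h4] at h1
  refine h1.trans ((map_add_le_add p.toSeminorm _ _).trans ?_)
  rw [map_smul_eq_mul, norm_pow, Complex.norm_real, Real.norm_eq_abs, sq_abs]
  gcongr
  calc p (star a * (inner A ξ ξ * a)) ≤ p (star a) * (p (inner A ξ ξ) * p a) :=
        (p.mul_le' _ _).trans (mul_le_mul_of_nonneg_left (p.mul_le' _ _) (p.nonneg _))
    _ = p (inner A ξ ξ) * p a ^ 2 := by rw [p.star_eq]; ring

/-- The Cauchy–Schwarz inequality. -/
theorem cauchy_schwarz (p : CStarSeminorm A) (ξ η : E) :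
    p (inner A ξ η) ≤ modNorm p ξ * modNorm p η := by
  have h := cauchy_schwarz_aux p ξ η
  have key : p (inner A ξ η) ^ 2 ≤ p (inner A ξ ξ) * p (inner A η η) := by
    rcases (p.nonneg (inner A ξ ξ)).eq_or_lt with h0 | h0
    · rw [← h0, zero_mul]
      simp only [← h0, zero_mul, mul_zero, add_zero] at h
      by_contra hlt
      push Not at hlt
      have h5 := h ((p (inner A η η) + 1) / p (inner A ξ η) ^ 2)
        (div_nonneg (by linarith [p.nonneg (inner A η η)]) hlt.le)
      rw [mul_assoc, div_mul_cancel₀ _ hlt.ne'] at h5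
      linarith [p.nonneg (inner A η η)]
    · have h5 := h (p (inner A ξ ξ))⁻¹ (by positivity)
      field_simp at h5
      nlinarith
  rw [modNorm, modNorm, ← Real.sqrt_mul (p.nonneg _)]
  exact Real.le_sqrt_of_sq_le key

theorem modNorm_add_le (p : CStarSeminorm A) (ξ η : E) :
    modNorm p (ξ + η) ≤ modNorm p ξ + modNorm p η := by
  refine abs_le_of_sq_le_sq' ?_ (add_nonneg (modNorm_nonneg p ξ) (modNorm_nonneg p η)) |>.2
  have e : inner A (ξ + η) (ξ + η)
      = (inner A ξ ξ + inner A ξ η) + (inner A η ξ + inner A η η) := by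
    rw [ip_add_left, ip_add_right, ip_add_right]
  rw [modNorm_sq, e]
  have h1 := map_add_le_add p.toSeminorm (inner A ξ ξ + inner A ξ η) (inner A η ξ + inner A η η)
  have h2 := map_add_le_add p.toSeminorm (inner A ξ ξ) (inner A ξ η)
  have h3 := map_add_le_add p.toSeminorm (inner A η ξ) (inner A η η)
  have h4 := cauchy_schwarz p ξ η
  have h5 := cauchy_schwarz p η ξ
  have h6 := modNorm_sq p ξ
  have h7 := modNorm_sq p η
  nlinarith

theorem modNorm_smul (p : CStarSeminorm A) (c : ℂ) (ξ : E) :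
    modNorm p (c • ξ) = ‖c‖ * modNorm p ξ := by
  rw [modNorm, ip_smul_left, ip_smul_right, smul_smul, map_smul_eq_mul, norm_mul,
    norm_star, Real.sqrt_mul (by positivity), Real.sqrt_mul_self (norm_nonneg c), modNorm]

theorem modNorm_zero (p : CStarSeminorm A) : modNorm p (0 : E) = 0 := by
  simpa using modNorm_smul p 0 (0 : E)

theorem modNorm_neg (p : CStarSeminorm A) (ξ : E) : modNorm p (-ξ) = modNorm p ξ := by
  simpa using modNorm_smul p (-1) ξ

theorem modNorm_rsmul_le (p : CStarSeminorm A) (ξ : E) (a : A) :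
    modNorm p (ξ <• a) ≤ modNorm p ξ * p a := by
  refine abs_le_of_sq_le_sq' ?_ (mul_nonneg (modNorm_nonneg p ξ) (p.nonneg a)) |>.2
  rw [modNorm_sq, inner_rsmul_left, inner_rsmul_right, mul_pow, modNorm_sq]
  calc p (star a * (inner A ξ ξ * a)) ≤ p (star a) * (p (inner A ξ ξ) * p a) :=
        (p.mul_le' _ _).trans (mul_le_mul_of_nonneg_left (p.mul_le' _ _) (p.nonneg _))
    _ = p (inner A ξ ξ) * p a ^ 2 := by rw [p.star_eq]; ring

end IsHilbertModule

/-- The inner product `⟨a, b⟩ = a⋆ b` of `A` as a module over itself. -/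
instance selfInner (A : Type*) [NonUnitalRing A] [StarRing A] : Inner A A := ⟨fun a b => star a * b⟩

theorem inner_self_def {A : Type*} [NonUnitalRing A] [StarRing A] (a b : A) :
    inner A a b = star a * b := rfl

/-- A locally C⋆-algebra is a Hilbert module over itself. -/
instance selfHilbertModule (A : Type*) [NonUnitalRing A] [StarRing A] [Module ℂ A] [UniformSpace A]
    [IsLocallyCStarAlgebra A] : IsHilbertModule A A where
  isUniformAddGroup := inferInstance
  completeSpace := inferInstance
  add_rsmul ξ η a := add_mul ξ η a
  rsmul_add ξ a b := mul_add ξ a b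
  rsmul_mul ξ a b := (mul_assoc ξ a b).symm
  smul_rsmul c ξ a := smul_mul_assoc c ξ a
  rsmul_smul c ξ a := mul_smul_comm c ξ a
  ip_add_right ξ η ζ := mul_add _ _ _
  ip_smul_right c ξ η := mul_smul_comm _ _ _
  inner_rsmul_right ξ η a := (mul_assoc _ _ _).symm
  star_inner ξ η := by simp [inner_self_def]
  inner_self_pos ξ := ⟨ξ, rfl⟩
  inner_self_eq_zero a := by
    refine ⟨fun h => ?_, fun h => by simp [h, inner_self_def]⟩
    have h0 : ∀ p : ContCStarSeminorm A, p.toCStarSeminorm a = 0 := fun p => by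
      have := p.star_mul_self' a
      rw [← inner_self_def, h, map_zero] at this
      exact pow_eq_zero_iff (two_ne_zero) |>.1 this.symm
    have h1 : Tendsto (fun _ : ℕ => a) atTop (𝓝 0) := by
      rw [IsLocallyCStarAlgebra.nhds_zero, tendsto_iInf]
      intro p
      rw [tendsto_comap_iff]
      simp [Function.comp_def, h0]
    exact tendsto_nhds_unique tendsto_const_nhds h1
  nhds_zero := by
    rw [IsLocallyCStarAlgebra.nhds_zero]
    congr! 3 with p
    ext a
    rw [modNorm, inner_self_def, p.star_mul_self', Real.sqrt_sq (p.nonneg a)]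

section Operators

open IsHilbertModule

variable (A E F : Type*) [NonUnitalRing A] [StarRing A] [Module ℂ A] [UniformSpace A]
  [IsLocallyCStarAlgebra A]
  [AddCommGroup E] [Module ℂ E] [SMul Aᵐᵒᵖ E] [Inner A E] [UniformSpace E] [IsHilbertModule A E]
  [AddCommGroup F] [Module ℂ F] [SMul Aᵐᵒᵖ F] [Inner A F] [UniformSpace F] [IsHilbertModule A F]
  {E' F' : Type*}
  [AddCommGroup E'] [Module ℂ E'] [SMul Aᵐᵒᵖ E'] [Inner A E'] [UniformSpace E']
  [IsHilbertModule A E']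
  [AddCommGroup F'] [Module ℂ F'] [SMul Aᵐᵒᵖ F'] [Inner A F'] [UniformSpace F']
  [IsHilbertModule A F']

/-- The adjointable module morphisms, as a space of linear maps. -/
def adjointableSubmodule : Submodule ℂ (E →ₗ[ℂ] F) where
  carrier := {T | (∀ (ξ : E) (a : A), T (ξ <• a) = T ξ <• a) ∧
    ∃ S : F →ₗ[ℂ] E, (∀ (η : F) (a : A), S (η <• a) = S η <• a) ∧
      ∀ ξ η, inner A (T ξ) η = inner A ξ (S η)}
  add_mem' := by
    rintro T T' ⟨h, S, hS, hTS⟩ ⟨h', S', hS', hTS'⟩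
    refine ⟨fun ξ a => by simp [h, h', add_rsmul], S + S',
      fun η a => by simp [hS, hS', add_rsmul], fun ξ η => ?_⟩
    simp [ip_add_left, ip_add_right, hTS, hTS']
  zero_mem' := by
    have hE : ∀ a : A, (0 : E) <• a = 0 := fun a => by
      simpa using smul_rsmul (0 : ℂ) (0 : E) a
    have hF : ∀ a : A, (0 : F) <• a = 0 := fun a => by
      simpa using smul_rsmul (0 : ℂ) (0 : F) a
    refine ⟨fun ξ a => by simp [hF], 0, fun η a => by simp [hE], fun ξ η => ?_⟩
    have h1 : inner A (0 : F) η = 0 := by simpa using ip_smul_left (A := A) 0 (0 : F) η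
    have h2 : inner A ξ (0 : E) = 0 := by simpa using ip_smul_right (A := A) 0 ξ (0 : E)
    simp [h1, h2]
  smul_mem' := by
    rintro c T ⟨h, S, hS, hTS⟩
    refine ⟨fun ξ a => by simp [h, smul_rsmul], star c • S,
      fun η a => by simp [hS, smul_rsmul], fun ξ η => ?_⟩
    simp [ip_smul_left, ip_smul_right, hTS]

/-- `L(E, F)`: the adjointable module morphisms from `E` to `F`. -/
def Adjointable : Type _ := adjointableSubmodule A E F

namespace Adjointable

instance : AddCommGroup (Adjointable A E F) :=
  inferInstanceAs (AddCommGroup (adjointableSubmodule A E F))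

instance : Module ℂ (Adjointable A E F) :=
  inferInstanceAs (Module ℂ (adjointableSubmodule A E F))

instance : CoeFun (Adjointable A E F) (fun _ => E → F) := ⟨fun T => T.1⟩

variable {A E F}

@[ext]
theorem ext {S T : Adjointable A E F} (h : ∀ ξ, S ξ = T ξ) : S = T :=
  Subtype.ext (LinearMap.ext h)

theorem map_rsmul (T : Adjointable A E F) (ξ : E) (a : A) : T (ξ <• a) = T ξ <• a := T.2.1 ξ a

theorem add_apply (S T : Adjointable A E F) (ξ : E) : (S + T) ξ = S ξ + T ξ := rfl
theorem sub_apply (S T : Adjointable A E F) (ξ : E) : (S - T) ξ = S ξ - T ξ := rfl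
theorem neg_apply (T : Adjointable A E F) (ξ : E) : (-T) ξ = -T ξ := rfl
theorem zero_apply (ξ : E) : (0 : Adjointable A E F) ξ = 0 := rfl
theorem smul_apply (c : ℂ) (T : Adjointable A E F) (ξ : E) : (c • T) ξ = c • T ξ := rfl

/-- The adjoint `T⋆` of an adjointable module morphism `T`. -/
def adj (T : Adjointable A E F) : Adjointable A F E :=
  ⟨Classical.choose T.2.2, (Classical.choose_spec T.2.2).1, T.1, T.2.1, fun η ξ => by
    rw [← star_inner, ← (Classical.choose_spec T.2.2).2, star_inner]⟩

theorem inner_apply_left (T : Adjointable A E F) (ξ : E) (η : F) :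
    inner A (T ξ) η = inner A ξ (T.adj η) := (Classical.choose_spec T.2.2).2 ξ η

theorem inner_apply_right (T : Adjointable A E F) (η : F) (ξ : E) :
    inner A η (T ξ) = inner A (T.adj η) ξ := by
  rw [← star_inner, inner_apply_left, star_inner]

theorem eq_adj {T : Adjointable A E F} {S : Adjointable A F E}
    (h : ∀ ξ η, inner A (T ξ) η = inner A ξ (S η)) : S = T.adj :=
  ext fun η => ext_inner (A := A) fun ξ => by rw [← h, inner_apply_left]

theorem adj_adj (T : Adjointable A E F) : T.adj.adj = T :=
  (eq_adj fun η ξ => (inner_apply_right T η ξ).symm).symm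

/-- Composition of adjointable module morphisms. -/
def comp (S : Adjointable A F F') (T : Adjointable A E F) : Adjointable A E F' :=
  ⟨S.1 ∘ₗ T.1, fun ξ a => by
    change S (T (ξ <• a)) = S (T ξ) <• a
    rw [map_rsmul, map_rsmul], T.adj.1 ∘ₗ S.adj.1, fun η a => by
    change T.adj (S.adj (η <• a)) = T.adj (S.adj η) <• a
    rw [map_rsmul, map_rsmul], fun ξ η => by
    change inner A (S (T ξ)) η = inner A ξ (T.adj (S.adj η))
    rw [inner_apply_left, inner_apply_left]⟩

theorem comp_apply (S : Adjointable A F F') (T : Adjointable A E F) (ξ : E) :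
    S.comp T ξ = S (T ξ) := rfl

theorem map_add (T : Adjointable A E F) (ξ η : E) : T (ξ + η) = T ξ + T η := T.1.map_add ξ η
theorem map_smul (T : Adjointable A E F) (c : ℂ) (ξ : E) : T (c • ξ) = c • T ξ :=
  T.1.map_smul c ξ

theorem adj_comp (S : Adjointable A F F') (T : Adjointable A E F) :
    (S.comp T).adj = T.adj.comp S.adj :=
  (eq_adj fun ξ η => by rw [comp_apply, comp_apply, inner_apply_left, inner_apply_left]).symm

theorem adj_add (S T : Adjointable A E F) : (S + T).adj = S.adj + T.adj :=
  (eq_adj fun ξ η => by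
    rw [add_apply, add_apply, ip_add_left, ip_add_right, inner_apply_left,
      inner_apply_left]).symm

theorem adj_smul (c : ℂ) (T : Adjointable A E F) : (c • T).adj = star c • T.adj :=
  (eq_adj fun ξ η => by
    rw [smul_apply, smul_apply, ip_smul_left, ip_smul_right, inner_apply_left]).symm

/-- The rank one operator `θ_{η, ξ}`, `ζ ↦ η ⟨ξ, ζ⟩`. -/
def theta (η : F) (ξ : E) : Adjointable A E F :=
  ⟨{ toFun := fun ζ => η <• inner A ξ ζ
     map_add' := fun ζ ζ' => by rw [ip_add_right, rsmul_add]
     map_smul' := fun c ζ => by rw [ip_smul_right, rsmul_smul]; rfl },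
   fun ζ a => by
    change η <• inner A ξ (ζ <• a) = (η <• inner A ξ ζ) <• a
    rw [inner_rsmul_right, rsmul_mul],
   { toFun := fun ζ => ξ <• inner A η ζ
     map_add' := fun ζ ζ' => by rw [ip_add_right, rsmul_add]
     map_smul' := fun c ζ => by rw [ip_smul_right, rsmul_smul]; rfl },
   fun ζ a => by
    change ξ <• inner A η (ζ <• a) = (ξ <• inner A η ζ) <• a
    rw [inner_rsmul_right, rsmul_mul],
   fun ζ ζ' => by
    change inner A (η <• inner A ξ ζ) ζ' = inner A ζ (ξ <• inner A η ζ')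
    rw [inner_rsmul_left, inner_rsmul_right, star_inner]⟩

theorem theta_apply (η : F) (ξ ζ : E) : (theta η ξ : Adjointable A E F) ζ = η <• inner A ξ ζ := rfl

theorem adj_theta (η : F) (ξ : E) : (theta η ξ : Adjointable A E F).adj = theta ξ η :=
  (eq_adj fun ζ ζ' => by
    rw [theta_apply, theta_apply, inner_rsmul_left, inner_rsmul_right, star_inner]).symm

theorem comp_theta (S : Adjointable A F F') (η : F) (ξ : E) :
    S.comp (theta η ξ : Adjointable A E F) = theta (S η) ξ :=
  ext fun ζ => by rw [comp_apply, theta_apply, theta_apply, map_rsmul]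

/-- The operator seminorm on `L(E, F)` attached to `p`: the supremum of the `p`-seminorms of `T ξ`
over the `ξ` of `p`-seminorm at most one. It is the norm of the operator induced by `T` between the
quotients of `E` and `F` by the kernels of the `p`-seminorms. -/
def opNorm (p : CStarSeminorm A) (T : Adjointable A E F) : ENNReal :=
  ⨆ (ξ : E) (_ : modNorm p ξ ≤ 1), ENNReal.ofReal (modNorm p (T ξ))

theorem opNorm_le {p : CStarSeminorm A} {T : Adjointable A E F} {C : ℝ} (hC : 0 ≤ C)
    (h : ∀ ξ, modNorm p (T ξ) ≤ C * modNorm p ξ) : opNorm p T ≤ ENNReal.ofReal C :=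
  iSup₂_le fun ξ hξ => ENNReal.ofReal_le_ofReal
    ((h ξ).trans (mul_le_of_le_one_right hC hξ))

theorem le_opNorm {p : CStarSeminorm A} {T : Adjointable A E F} (hT : opNorm p T ≠ ⊤) (ξ : E) :
    modNorm p (T ξ) ≤ (opNorm p T).toReal * modNorm p ξ := by
  have h1 : ∀ ζ : E, modNorm p ζ ≤ 1 → modNorm p (T ζ) ≤ (opNorm p T).toReal := fun ζ hζ =>
    (ENNReal.ofReal_le_iff_le_toReal hT).1
      (le_iSup₂ (f := fun (ζ : E) (_ : modNorm p ζ ≤ 1) => ENNReal.ofReal (modNorm p (T ζ))) ζ hζ)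
  have h2 : ∀ t : ℝ, 0 ≤ t → t * modNorm p ξ ≤ 1 → t * modNorm p (T ξ) ≤ (opNorm p T).toReal := by
    intro t ht h
    have := h1 ((t : ℂ) • ξ) (by
      rwa [modNorm_smul, Complex.norm_real, Real.norm_of_nonneg ht])
    rwa [map_smul, modNorm_smul, Complex.norm_real, Real.norm_of_nonneg ht] at this
  rcases (modNorm_nonneg p ξ).eq_or_lt with h0 | h0
  · rw [← h0, mul_zero]
    by_contra hlt
    push Not at hlt
    have := h2 (((opNorm p T).toReal + 1) / modNorm p (T ξ)) (by positivity) (by simp [← h0])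
    rw [div_mul_cancel₀ _ hlt.ne'] at this
    linarith
  · have := h2 (modNorm p ξ)⁻¹ (by positivity) (by rw [inv_mul_cancel₀ h0.ne'])
    rwa [inv_mul_le_iff₀ h0, mul_comm] at this

theorem opNorm_zero (p : CStarSeminorm A) : opNorm p (0 : Adjointable A E F) = 0 := by
  simp [opNorm, zero_apply, modNorm_zero]

theorem opNorm_neg (p : CStarSeminorm A) (T : Adjointable A E F) : opNorm p (-T) = opNorm p T := by
  simp [opNorm, neg_apply, modNorm_neg]

theorem opNorm_add_le (p : CStarSeminorm A) (S T : Adjointable A E F) :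
    opNorm p (S + T) ≤ opNorm p S + opNorm p T :=
  iSup₂_le fun ξ hξ => by
    rw [add_apply]
    refine (ENNReal.ofReal_le_ofReal (modNorm_add_le p _ _)).trans ?_
    rw [ENNReal.ofReal_add (modNorm_nonneg p _) (modNorm_nonneg p _)]
    exact add_le_add
      (le_iSup₂ (f := fun (ζ : E) (_ : modNorm p ζ ≤ 1) => ENNReal.ofReal (modNorm p (S ζ))) ξ hξ)
      (le_iSup₂ (f := fun (ζ : E) (_ : modNorm p ζ ≤ 1) => ENNReal.ofReal (modNorm p (T ζ))) ξ hξ)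

theorem opNorm_smul_le (p : CStarSeminorm A) (c : ℂ) (T : Adjointable A E F) :
    opNorm p (c • T) ≤ ‖c‖₊ * opNorm p T :=
  iSup₂_le fun ξ hξ => by
    rw [smul_apply, modNorm_smul, ENNReal.ofReal_mul (norm_nonneg c), ofReal_norm]
    exact mul_le_mul_right
      (le_iSup₂ (f := fun (ζ : E) (_ : modNorm p ζ ≤ 1) => ENNReal.ofReal (modNorm p (T ζ))) ξ hξ) _

theorem opNorm_comp_le (p : CStarSeminorm A) {S : Adjointable A F F'} (hS : opNorm p S ≠ ⊤)
    (T : Adjointable A E F) : opNorm p (S.comp T) ≤ (opNorm p S).toNNReal * opNorm p T :=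
  iSup₂_le fun ξ hξ => by
    rw [comp_apply]
    refine (ENNReal.ofReal_le_ofReal (le_opNorm hS _)).trans ?_
    rw [ENNReal.ofReal_mul ENNReal.toReal_nonneg, ENNReal.ofReal_toReal hS,
      ENNReal.coe_toNNReal hS]
    exact mul_le_mul_right
      (le_iSup₂ (f := fun (ζ : E) (_ : modNorm p ζ ≤ 1) => ENNReal.ofReal (modNorm p (T ζ))) ξ hξ) _

theorem opNorm_adj_le (p : CStarSeminorm A) (T : Adjointable A E F) :
    opNorm p T.adj ≤ opNorm p T := by
  by_cases hT : opNorm p T = ⊤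
  · simp [hT]
  rw [← ENNReal.ofReal_toReal hT]
  refine opNorm_le ENNReal.toReal_nonneg fun η => ?_
  have h1 : modNorm p (T.adj η) ^ 2 ≤ modNorm p (T (T.adj η)) * modNorm p η := by
    rw [modNorm_sq, ← inner_apply_left]
    exact cauchy_schwarz p _ _
  have h2 := le_opNorm hT (T.adj η)
  have h3 := modNorm_nonneg p η
  rcases (modNorm_nonneg p (T.adj η)).eq_or_lt with h0 | h0
  · rw [← h0]; positivity
  · refine le_of_mul_le_mul_right ?_ h0
    nlinarith

theorem opNorm_theta_ne_top (p : CStarSeminorm A) (η : F) (ξ : E) :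
    opNorm p (theta η ξ : Adjointable A E F) ≠ ⊤ := by
  refine ((opNorm_le (mul_nonneg (modNorm_nonneg p η) (modNorm_nonneg p ξ)) fun ζ => ?_).trans_lt
    ENNReal.ofReal_lt_top).ne
  rw [theta_apply, mul_assoc]
  exact (modNorm_rsmul_le p _ _).trans
    (mul_le_mul_of_nonneg_left (cauchy_schwarz p _ _) (modNorm_nonneg p η))

variable (E F) in
/-- The (pseudo-)distance `(S, T) ↦ ‖S - T‖_p` on `L(E, F)`. -/
@[reducible]
def opDist (p : CStarSeminorm A) : PseudoEMetricSpace (Adjointable A E F) where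
  edist S T := opNorm p (S - T)
  edist_self T := by rw [sub_self, opNorm_zero]
  edist_comm S T := by rw [← opNorm_neg, neg_sub]
  edist_triangle S T R := by
    rw [← sub_add_sub_cancel S T R]
    exact opNorm_add_le p _ _

theorem isUniformAddGroup_opDist (p : CStarSeminorm A) :
    @IsUniformAddGroup (Adjointable A E F) (opDist E F p).toUniformSpace _ := by
  let _ := opDist E F p
  refine ⟨EMetric.uniformContinuous_iff.2 fun ε hε => ⟨ε / 2, ENNReal.half_pos hε.ne', ?_⟩⟩
  rintro ⟨S, T⟩ ⟨S', T'⟩ h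
  rw [Prod.edist_eq, max_lt_iff] at h
  change opNorm _ (S - T - (S' - T')) < ε
  have e : S - T - (S' - T') = (S - S') + -(T - T') := by abel
  rw [e]
  refine (opNorm_add_le _ _ _).trans_lt ?_
  rw [opNorm_neg, ← ENNReal.add_halves ε]
  exact ENNReal.add_lt_add h.1 h.2

/-- The topology (and uniformity) of `L(E, F)` is given by the operator seminorms attached to the
continuous C⋆-seminorms of `A`. -/
instance : UniformSpace (Adjointable A E F) :=
  ⨅ p : ContCStarSeminorm A, (opDist E F p.toCStarSeminorm).toUniformSpace

theorem continuous_of_bound (f : Adjointable A E F →+ Adjointable A E' F')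
    (h : ∀ p : ContCStarSeminorm A, ∃ C : NNReal,
      ∀ T, opNorm p.toCStarSeminorm (f T) ≤ C * opNorm p.toCStarSeminorm T) :
    Continuous f := by
  refine UniformContinuous.continuous (uniformContinuous_iInf_rng.2 fun p => ?_)
  refine uniformContinuous_iInf_dom (i := p) ?_
  obtain ⟨C, hC⟩ := h p
  let _ := opDist E F p.toCStarSeminorm
  let _ := opDist E' F' p.toCStarSeminorm
  refine LipschitzWith.uniformContinuous (K := C) fun S T => ?_
  change opNorm _ (f S - f T) ≤ C * opNorm _ (S - T)
  rw [← _root_.map_sub]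
  exact hC _

instance : IsUniformAddGroup (Adjointable A E F) :=
  isUniformAddGroup_iInf fun p => isUniformAddGroup_opDist p.toCStarSeminorm

instance : ContinuousConstSMul ℂ (Adjointable A E F) :=
  ⟨fun c => continuous_of_bound (DistribSMul.toAddMonoidHom (Adjointable A E F) c)
    fun _ => ⟨‖c‖₊, opNorm_smul_le _ c⟩⟩

end Adjointable

open Adjointable

/-- `Θ(E, F)`: the span of the rank one operators. -/
def finiteRank : Submodule ℂ (Adjointable A E F) :=
  Submodule.span ℂ {T | ∃ (η : F) (ξ : E), T = theta η ξ}

/-- `K(E, F)`: the closure of `Θ(E, F)` in `L(E, F)`. -/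
def compacts : Submodule ℂ (Adjointable A E F) := (finiteRank A E F).topologicalClosure

/-- `K(E, F)` as a type, with the topology inherited from `L(E, F)`. -/
abbrev CompactOp : Type _ := compacts A E F

variable {A E F}

theorem opNorm_ne_top_of_finiteRank (p : CStarSeminorm A) {T : Adjointable A E F}
    (hT : T ∈ finiteRank A E F) : opNorm p T ≠ ⊤ := by
  refine Submodule.span_induction (p := fun T _ => opNorm p T ≠ ⊤) ?_ ?_ ?_ ?_ hT
  · rintro _ ⟨η, ξ, rfl⟩
    exact opNorm_theta_ne_top p η ξ
  · simp [opNorm_zero]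
  · intro S T _ _ hS hT
    exact ((opNorm_add_le p S T).trans_lt (ENNReal.add_lt_top.2 ⟨hS.lt_top, hT.lt_top⟩)).ne
  · intro c T _ hT
    exact ((opNorm_smul_le p c T).trans_lt (ENNReal.mul_lt_top (by simp) hT.lt_top)).ne

theorem opNorm_ne_top (p : ContCStarSeminorm A) {T : Adjointable A E F}
    (hT : T ∈ compacts A E F) : opNorm p.toCStarSeminorm T ≠ ⊤ := by
  have hU : {S : Adjointable A E F | opNorm p.toCStarSeminorm (S - T) < 1} ∈ 𝓝 T := by
    have h1 : (instUniformSpace : UniformSpace (Adjointable A E F)) ≤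
      (opDist E F p.toCStarSeminorm).toUniformSpace := iInf_le _ p
    refine nhds_mono (UniformSpace.toTopologicalSpace_mono h1) ?_
    let _ := opDist E F p.toCStarSeminorm
    exact Metric.eball_mem_nhds T one_pos
  obtain ⟨S, hS, hS'⟩ := mem_closure_iff_nhds.1 hT _ hU
  have e : T = S + -(S - T) := by abel
  rw [e]
  refine ((opNorm_add_le _ _ _).trans_lt (ENNReal.add_lt_top.2
    ⟨(opNorm_ne_top_of_finiteRank _ hS').lt_top, ?_⟩)).ne
  rw [opNorm_neg]
  exact lt_trans hS ENNReal.one_lt_top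

theorem theta_mem_compacts (η : F) (ξ : E) : theta η ξ ∈ compacts A E F :=
  Submodule.le_topologicalClosure _ (Submodule.subset_span ⟨η, ξ, rfl⟩)

theorem continuous_comp_left {S : Adjointable A F F'} (hS : S ∈ compacts A F F') :
    Continuous fun T : Adjointable A E F => S.comp T :=
  continuous_of_bound (AddMonoidHom.mk' (fun T : Adjointable A E F => S.comp T)
    fun T T' => Adjointable.ext fun ξ => S.map_add (T ξ) (T' ξ))
    fun p => ⟨(opNorm p.toCStarSeminorm S).toNNReal, opNorm_comp_le _ (opNorm_ne_top p hS)⟩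

theorem comp_mem_compacts {S : Adjointable A F F'} {T : Adjointable A E F}
    (hS : S ∈ compacts A F F') (hT : T ∈ compacts A E F) : S.comp T ∈ compacts A E F' := by
  let f : Adjointable A E F →ₗ[ℂ] Adjointable A E F' :=
    { toFun := fun T => S.comp T
      map_add' := fun T T' => Adjointable.ext fun ξ => S.map_add (T ξ) (T' ξ)
      map_smul' := fun c T => Adjointable.ext fun ξ => S.map_smul c (T ξ) }
  have hf : Continuous f := continuous_comp_left hS
  refine map_mem_closure hf hT fun R hR => ?_
  have : finiteRank A E F ≤ (finiteRank A E F').comap f := by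
    refine Submodule.span_le.2 ?_
    rintro _ ⟨η, ξ, rfl⟩
    exact Submodule.subset_span ⟨S η, ξ, comp_theta S η ξ⟩
  exact this hR

theorem adj_mem_compacts {T : Adjointable A E F} (hT : T ∈ compacts A E F) :
    T.adj ∈ compacts A F E := by
  let f : Adjointable A E F →+ Adjointable A F E := AddMonoidHom.mk' adj adj_add
  have hf : Continuous f := continuous_of_bound f fun p =>
    ⟨1, fun T => by rw [ENNReal.coe_one, one_mul]; exact opNorm_adj_le _ T⟩
  refine map_mem_closure hf hT fun R hR => ?_
  refine Submodule.span_induction (p := fun R _ => R.adj ∈ finiteRank A F E) ?_ ?_ ?_ ?_ hR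
  · rintro _ ⟨η, ξ, rfl⟩
    exact Submodule.subset_span ⟨ξ, η, adj_theta η ξ⟩
  · have : (0 : Adjointable A E F).adj = 0 := f.map_zero
    rw [this]; exact Submodule.zero_mem _
  · intro S T _ _ hS hT
    rw [adj_add]; exact Submodule.add_mem _ hS hT
  · intro c T _ hT
    rw [adj_smul]; exact Submodule.smul_mem _ _ hT

namespace CompactOp

/-- `θ_{η, ξ}` as an element of `K(E, F)`. -/
def theta (η : F) (ξ : E) : CompactOp A E F := ⟨Adjointable.theta η ξ, theta_mem_compacts η ξ⟩

/-- Composition `K(F, F') × K(E, F) → K(E, F')`. -/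
def comp (S : CompactOp A F F') (T : CompactOp A E F) : CompactOp A E F' :=
  ⟨S.1.comp T.1, comp_mem_compacts S.2 T.2⟩

/-- The adjoint `K(E, F) → K(F, E)`. -/
def adj (T : CompactOp A E F) : CompactOp A F E := ⟨T.1.adj, adj_mem_compacts T.2⟩

@[ext]
theorem ext {S T : CompactOp A E F} (h : ∀ ξ, S.1 ξ = T.1 ξ) : S = T :=
  Subtype.ext (Adjointable.ext h)

instance : Mul (CompactOp A E E) := ⟨comp⟩

/-- `K(E)` is a ring under composition. -/
instance : NonUnitalRing (CompactOp A E E) where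
  __ := (inferInstance : AddCommGroup (CompactOp A E E))
  __ := (inferInstance : Mul (CompactOp A E E))
  zero_mul _ := ext fun _ => rfl
  mul_zero S := ext fun _ => S.1.1.map_zero
  mul_assoc _ _ _ := ext fun _ => rfl
  left_distrib S T T' := ext fun ξ => S.1.map_add (T.1 ξ) (T'.1 ξ)
  right_distrib _ _ _ := ext fun _ => rfl

/-- The involution of `K(E)` is the adjoint. -/
instance : StarRing (CompactOp A E E) where
  star := adj
  star_involutive T := Subtype.ext T.1.adj_adj
  star_mul S T := Subtype.ext (adj_comp S.1 T.1)
  star_add S T := Subtype.ext (adj_add S.1 T.1)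

/-- The right action of `K(E)` on `K(E, A)` is composition. -/
instance : SMul (CompactOp A E E)ᵐᵒᵖ (CompactOp A E A) := ⟨fun k T => T.comp k.unop⟩

/-- The `K(E)`-valued inner product of `K(E, A)` is `⟨S, T⟩ = S⋆ T`. -/
instance : Inner (CompactOp A E E) (CompactOp A E A) := ⟨fun S T => S.adj.comp T⟩

end CompactOp

end Operators

section Actions

/-- The group of automorphisms of the locally C⋆-algebra `A`: the ⋆-isomorphisms of `A` onto itself
that are continuous along with their inverses. -/
def AlgAut (A : Type*) [NonUnitalRing A] [StarRing A] [Module ℂ A] [TopologicalSpace A] :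
    Subgroup (A ≃⋆ₐ[ℂ] A) where
  carrier := {f | Continuous f ∧ Continuous f.symm}
  mul_mem' := fun hf hg => ⟨hf.1.comp hg.1, hg.2.comp hf.2⟩
  one_mem' := ⟨continuous_id, continuous_id⟩
  inv_mem' := fun hf => ⟨hf.2, hf.1⟩

/-- `u : E → F` is a morphism of Hilbert modules (over `A` and `B`) if there is a morphism
`α : A → B` of locally C⋆-algebras with `⟨u ξ, u η⟩ = α ⟨ξ, η⟩`. -/
def IsHilbertMorphism (A B : Type*) {E F : Type*} [NonUnitalRing A] [StarRing A] [Module ℂ A]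
    [TopologicalSpace A] [NonUnitalRing B] [StarRing B] [Module ℂ B] [TopologicalSpace B]
    [Inner A E] [Inner B F] (u : E → F) : Prop :=
  ∃ α : A →⋆ₙₐ[ℂ] B, Continuous α ∧ ∀ ξ η : E, inner B (u ξ) (u η) = α (inner A ξ η)

variable (A E : Type*) [NonUnitalRing A] [StarRing A] [Module ℂ A] [TopologicalSpace A] [Inner A E]

/-- `Aut(E)`: the bijections `u` of `E` such that `u` and `u⁻¹` are morphisms of Hilbert
modules. -/
def HilbertAut : Subgroup (Equiv.Perm E) where
  carrier := {u | IsHilbertMorphism A A u ∧ IsHilbertMorphism A A u.symm}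
  mul_mem' := by
    rintro u v ⟨⟨α, hα, h⟩, α', hα', h'⟩ ⟨⟨β, hβ, k⟩, β', hβ', k'⟩
    exact ⟨⟨α.comp β, hα.comp hβ, fun ξ η => by simp [h, k]⟩,
      ⟨β'.comp α', hβ'.comp hα', fun ξ η => by
        change inner A (v.symm (u.symm ξ)) (v.symm (u.symm η)) = _
        simp [h', k']⟩⟩
  one_mem' := ⟨⟨NonUnitalStarAlgHom.id ℂ A, continuous_id, fun _ _ => rfl⟩,
    ⟨NonUnitalStarAlgHom.id ℂ A, continuous_id, fun _ _ => rfl⟩⟩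
  inv_mem' := fun h => ⟨h.2, h.1⟩

/-- An action of `G` on the Hilbert `A`-module `E` is a group homomorphism `G → Aut(E)`. -/
abbrev HilbertAction (G : Type*) [Group G] : Type _ := G →* HilbertAut A E

/-- An action of `G` on the locally C⋆-algebra `A` is a group homomorphism `G → Aut(A)`. -/
abbrev AlgAction (G A : Type*) [Group G] [NonUnitalRing A] [StarRing A] [Module ℂ A]
    [TopologicalSpace A] : Type _ := G →* AlgAut A

end Actions

/-- An inverse system of Hilbert C⋆-modules `mod i` over C⋆-algebras `alg i`, indexed by `Λ`. -/
structure HilbertSystem.{uΛ, uA, uE} (Λ : Type uΛ) [Preorder Λ] where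
  alg : Λ → Type uA
  mod : Λ → Type uE
  [cstar : ∀ i, NonUnitalCStarAlgebra (alg i)]
  [addCommGroup : ∀ i, AddCommGroup (mod i)]
  [module : ∀ i, Module ℂ (mod i)]
  [rsmul : ∀ i, SMul (alg i)ᵐᵒᵖ (mod i)]
  [innerProd : ∀ i, Inner (alg i) (mod i)]
  [uniformSpace : ∀ i, UniformSpace (mod i)]
  [hilbert : ∀ i, IsHilbertModule (alg i) (mod i)]
  algMap : ∀ {i j : Λ}, i ≤ j → alg j →⋆ₙₐ[ℂ] alg i
  modMap : ∀ {i j : Λ}, i ≤ j → mod j →ₗ[ℂ] mod i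
  algMap_refl : ∀ i (a : alg i), algMap (le_refl i) a = a
  algMap_comp : ∀ {i j k} (hij : i ≤ j) (hjk : j ≤ k) (a : alg k),
    algMap hij (algMap hjk a) = algMap (hij.trans hjk) a
  modMap_refl : ∀ i (ξ : mod i), modMap (le_refl i) ξ = ξ
  modMap_comp : ∀ {i j k} (hij : i ≤ j) (hjk : j ≤ k) (ξ : mod k),
    modMap hij (modMap hjk ξ) = modMap (hij.trans hjk) ξ
  modMap_rsmul : ∀ {i j} (hij : i ≤ j) (ξ : mod j) (a : alg j),
    modMap hij (ξ <• a) = modMap hij ξ <• algMap hij a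
  inner_modMap : ∀ {i j} (hij : i ≤ j) (ξ η : mod j),
    inner (alg i) (modMap hij ξ) (modMap hij η) = algMap hij (inner (alg j) ξ η)

attribute [instance] HilbertSystem.cstar HilbertSystem.addCommGroup HilbertSystem.module
  HilbertSystem.rsmul HilbertSystem.innerProd HilbertSystem.uniformSpace HilbertSystem.hilbert

/-- An identification of the locally C⋆-algebra `A` and of the Hilbert `A`-module `E` with the
inverse limits of an inverse system of Hilbert C⋆-modules. The maps `a ↦ (π i a)ᵢ` and
`ξ ↦ (σ i ξ)ᵢ` are bijections onto the sets of coherent families, homeomorphic for the product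
topologies, and respect the algebraic structure. -/
structure HilbertSystem.Limit {Λ : Type*} [Preorder Λ] (D : HilbertSystem Λ) (A E : Type*)
    [NonUnitalRing A] [StarRing A] [Module ℂ A] [TopologicalSpace A]
    [AddCommGroup E] [Module ℂ E] [SMul Aᵐᵒᵖ E] [Inner A E] [TopologicalSpace E] where
  π : ∀ i, A →⋆ₙₐ[ℂ] D.alg i
  σ : ∀ i, E →ₗ[ℂ] D.mod i
  algMap_π : ∀ {i j} (hij : i ≤ j) (a : A), D.algMap hij (π j a) = π i a
  modMap_σ : ∀ {i j} (hij : i ≤ j) (ξ : E), D.modMap hij (σ j ξ) = σ i ξ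
  σ_rsmul : ∀ i (ξ : E) (a : A), σ i (ξ <• a) = σ i ξ <• π i a
  inner_σ : ∀ i (ξ η : E), inner (D.alg i) (σ i ξ) (σ i η) = π i (inner A ξ η)
  existsUnique_alg : ∀ x : ∀ i, D.alg i, (∀ i j (hij : i ≤ j), D.algMap hij (x j) = x i) →
    ∃! a : A, ∀ i, π i a = x i
  existsUnique_mod : ∀ x : ∀ i, D.mod i, (∀ i j (hij : i ≤ j), D.modMap hij (x j) = x i) →
    ∃! ξ : E, ∀ i, σ i ξ = x i
  isInducing_alg : IsInducing fun (a : A) (i : Λ) => π i a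
  isInducing_mod : IsInducing fun (ξ : E) (i : Λ) => σ i ξ

section Limits

universe uA uE

variable {A : Type uA} {E : Type uE} [NonUnitalRing A] [StarRing A] [Module ℂ A]
  [TopologicalSpace A] [AddCommGroup E] [Module ℂ E] [SMul Aᵐᵒᵖ E] [Inner A E]
  [TopologicalSpace E] {G : Type*} [Group G]

/-- The action `u` is continuous if `g ↦ u g ξ` is continuous for each `ξ`. -/
def IsContinuousAction [TopologicalSpace G] (u : HilbertAction A E G) : Prop :=
  ∀ ξ : E, Continuous fun g => (u g).1 ξ

/-- The action `u` is an inverse limit action if `E` can be written as the inverse limit of Hilbert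
C⋆-modules over a directed set in such a way that `u` is the inverse limit of actions `v i` on
these. -/
def IsInverseLimitAction (u : HilbertAction A E G) : Prop :=
  ∃ (Λ : Type uA) (_ : Preorder Λ) (_ : IsDirectedOrder Λ) (_ : Nonempty Λ)
    (D : HilbertSystem.{uA, uA, uE} Λ) (L : D.Limit A E)
    (v : ∀ i, HilbertAction (D.alg i) (D.mod i) G),
    (∀ {i j} (hij : i ≤ j) (g : G) (x : D.mod j),
      D.modMap hij ((v j g).1 x) = (v i g).1 (D.modMap hij x)) ∧
    ∀ i (g : G) (ξ : E), L.σ i ((u g).1 ξ) = (v i g).1 (L.σ i ξ)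

end Limits

end

noncomputable section

/-! Write `ũ_g(T) = α_g T u_g⁻¹`. Apart from the Hilbert module structure of `K(E, A)`, everything
rests on C⋆-seminorms invariant under the group. If `u` is an inverse limit action and `E` is full,
then `α_g` descends to the C⋆-algebras of the inverse system, so the seminorms `a ↦ ‖π i a‖` are
`α`-invariant. The operator seminorms they define on `K(E)` are invariant and generate its topology,
and completing `K(E)` and `K(E, A)` with respect to the invariant seminorms exhibits `ũ` as an
inverse limit action. Invariance also makes the family `ũ_g` equicontinuous, so that the operators
with a continuous orbit form a closed subspace; it contains `θ_{a,ξ} = ⟨ξ a*, ·⟩` when `u` is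
continuous.

The positivity of `T* T` in `K(E)` is the one point of the Hilbert module structure that is not
formal: it is checked in each C⋆-completion of `K(E)`, and the square roots found there are
coherent. -/

section Seminorms

variable {ι κ V W X : Type*} [AddCommGroup V] [Module ℂ V] [TopologicalSpace V]
  [AddCommGroup W] [Module ℂ W] [TopologicalSpace W]
  {p : SeminormFamily ℂ V ι} {q : SeminormFamily ℂ W κ}

theorem tendsto_zero_iff_of_withSeminorms (hp : WithSeminorms p) {l : Filter X} {f : X → V} :
    Tendsto f l (𝓝 0) ↔ ∀ i, Tendsto (fun x => p i (f x)) l (𝓝 0) := by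
  have := hp.topologicalAddGroup
  rw [p.withSeminorms_iff_nhds_eq_iInf.1 hp, tendsto_iInf]
  simp only [tendsto_comap_iff, Function.comp_def]

theorem continuous_of_seminorm_le (hp : WithSeminorms p) (hq : WithSeminorms q) (f : V →+ W)
    (h : ∀ k, ∃ i C, ∀ v, q k (f v) ≤ C * p i v) : Continuous f := by
  have := hp.topologicalAddGroup
  have := hq.topologicalAddGroup
  refine continuous_of_continuousAt_zero f ?_
  rw [ContinuousAt, map_zero, tendsto_zero_iff_of_withSeminorms hq]
  intro k
  obtain ⟨i, C, hC⟩ := h k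
  refine squeeze_zero (fun _ => apply_nonneg _ _) hC ?_
  simpa using ((tendsto_zero_iff_of_withSeminorms hp).1 tendsto_id i).const_mul C

theorem t2Space_of_withSeminorms (hp : WithSeminorms p) (h : ∀ v, (∀ i, p i v = 0) → v = 0) :
    T2Space V := by
  have := hp.topologicalAddGroup
  have := hp.T1_of_separating fun v hv => by
    by_contra! h0
    exact hv (h v h0)
  infer_instance

end Seminorms

theorem IsLocallyCStarAlgebra.withSeminorms (A : Type*) [NonUnitalRing A] [StarRing A] [Module ℂ A]
    [UniformSpace A] [IsLocallyCStarAlgebra A] :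
    WithSeminorms fun p : ContCStarSeminorm A => p.toSeminorm :=
  (SeminormFamily.withSeminorms_iff_nhds_eq_iInf _).2 nhds_zero

namespace IsHilbertModule

variable {A E : Type*} [NonUnitalRing A] [StarRing A] [Module ℂ A] [UniformSpace A]
  [IsLocallyCStarAlgebra A]
  [AddCommGroup E] [Module ℂ E] [SMul Aᵐᵒᵖ E] [Inner A E] [UniformSpace E] [IsHilbertModule A E]

variable (E) in
/-- The seminorm `ξ ↦ p(⟨ξ, ξ⟩)^{1/2}` of a Hilbert module. -/
def modSeminorm (p : CStarSeminorm A) : Seminorm ℂ E :=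
  Seminorm.of (modNorm p) (modNorm_add_le p) (modNorm_smul p)

variable (A E) in
theorem withSeminorms :
    WithSeminorms fun p : ContCStarSeminorm A => modSeminorm E p.toCStarSeminorm := by
  have := isUniformAddGroup (A := A) (E := E)
  exact (SeminormFamily.withSeminorms_iff_nhds_eq_iInf _).2 (nhds_zero (A := A))

omit [UniformSpace A] [IsLocallyCStarAlgebra A] in
theorem modNorm_self (p : CStarSeminorm A) (a : A) : modNorm p a = p a := by
  rw [modNorm, inner_self_def, p.star_mul_self', Real.sqrt_sq (p.nonneg a)]

theorem tendsto_zero_iff {X : Type*} {l : Filter X} {f : X → E} :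
    Tendsto f l (𝓝 0) ↔
      ∀ p : ContCStarSeminorm A, Tendsto (fun x => modNorm p.toCStarSeminorm (f x)) l (𝓝 0) :=
  tendsto_zero_iff_of_withSeminorms (withSeminorms A E)

theorem continuous_modNorm (p : ContCStarSeminorm A) :
    Continuous (modNorm p.toCStarSeminorm : E → ℝ) :=
  (withSeminorms A E).continuous_seminorm p

theorem eq_zero_of_modNorm {ξ : E}
    (h : ∀ p : ContCStarSeminorm A, modNorm p.toCStarSeminorm ξ = 0) : ξ = 0 := by
  rw [← inner_self_eq_zero (A := A)]
  by_contra hne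
  obtain ⟨p, hp⟩ := (IsLocallyCStarAlgebra.withSeminorms A).separating_of_T1 _ hne
  refine hp (show p.toCStarSeminorm _ = 0 from ?_)
  rw [← modNorm_sq, h, zero_pow two_ne_zero]

variable (A E) in
include A in
theorem t2Space : T2Space E :=
  t2Space_of_withSeminorms (withSeminorms A E) fun _ => eq_zero_of_modNorm

variable (A E) in
include A in
theorem continuousConstSMul : ContinuousConstSMul ℂ E :=
  have := (withSeminorms A E).continuousSMul
  inferInstance

theorem continuous_inner_right (ξ : E) : Continuous fun η : E => inner A ξ η :=
  continuous_of_seminorm_le (withSeminorms A E) (IsLocallyCStarAlgebra.withSeminorms A)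
    (AddMonoidHom.mk' (fun η : E => inner A ξ η) (ip_add_right ξ))
    fun p => ⟨p, modNorm p.toCStarSeminorm ξ, fun η => cauchy_schwarz _ ξ η⟩

theorem continuous_inner_left (ξ : E) : Continuous fun η : E => inner A η ξ :=
  continuous_of_seminorm_le (withSeminorms A E) (IsLocallyCStarAlgebra.withSeminorms A)
    (AddMonoidHom.mk' (fun η : E => inner A η ξ) (ip_add_left · · ξ))
    fun p => ⟨p, modNorm p.toCStarSeminorm ξ, fun η =>
      (cauchy_schwarz _ η ξ).trans_eq (mul_comm _ _)⟩

theorem continuous_rsmul_const (a : A) : Continuous fun ξ : E => ξ <• a :=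
  continuous_of_seminorm_le (withSeminorms A E) (withSeminorms A E)
    (AddMonoidHom.mk' (fun ξ : E => ξ <• a) (add_rsmul · · a))
    fun p => ⟨p, p.toCStarSeminorm a, fun ξ =>
      (modNorm_rsmul_le _ ξ a).trans_eq (mul_comm _ _)⟩

end IsHilbertModule

namespace Adjointable

open IsHilbertModule

variable {A E F : Type*} [NonUnitalRing A] [StarRing A] [Module ℂ A] [UniformSpace A]
  [IsLocallyCStarAlgebra A]
  [AddCommGroup E] [Module ℂ E] [SMul Aᵐᵒᵖ E] [Inner A E] [UniformSpace E] [IsHilbertModule A E]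
  [AddCommGroup F] [Module ℂ F] [SMul Aᵐᵒᵖ F] [Inner A F] [UniformSpace F] [IsHilbertModule A F]

theorem ofReal_modNorm_le_opNorm {p : CStarSeminorm A} (T : Adjointable A E F) {ξ : E}
    (hξ : modNorm p ξ ≤ 1) : ENNReal.ofReal (modNorm p (T ξ)) ≤ opNorm p T :=
  le_iSup₂ (f := fun (ζ : E) (_ : modNorm p ζ ≤ 1) => ENNReal.ofReal (modNorm p (T ζ))) ξ hξ

theorem opNorm_adj (p : CStarSeminorm A) (T : Adjointable A E F) : opNorm p T.adj = opNorm p T :=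
  (opNorm_adj_le p T).antisymm (by simpa only [adj_adj] using opNorm_adj_le p T.adj)

theorem nhds_zero_eq : 𝓝 (0 : Adjointable A E F) =
    ⨅ p : ContCStarSeminorm A, comap (opNorm p.toCStarSeminorm) (𝓝 0) := by
  change @nhds _ (⨅ p : ContCStarSeminorm A,
    (opDist E F p.toCStarSeminorm).toUniformSpace).toTopologicalSpace 0 = _
  rw [UniformSpace.toTopologicalSpace_iInf, nhds_iInf]
  refine iInf_congr fun p => ?_
  let _ := opDist E F p.toCStarSeminorm
  refine Metric.nhds_basis_eball.eq_of_same_basis ?_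
  have hbasis :=
    ENNReal.nhds_zero_basis.comap (opNorm p.toCStarSeminorm : Adjointable A E F → ENNReal)
  refine hbasis.congr (fun _ => Iff.rfl) fun ε _ => ?_
  ext T
  change opNorm _ T < ε ↔ opNorm _ (T - 0) < ε
  rw [sub_zero]

theorem tendsto_zero_iff {X : Type*} {l : Filter X} {f : X → Adjointable A E F} :
    Tendsto f l (𝓝 0) ↔
      ∀ p : ContCStarSeminorm A, Tendsto (fun x => opNorm p.toCStarSeminorm (f x)) l (𝓝 0) := by
  rw [nhds_zero_eq, tendsto_iInf]
  simp only [tendsto_comap_iff, Function.comp_def]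

variable (F) in
/-- Evaluation at `ξ`, as an additive map on `L(E, F)`. -/
def evalHom (ξ : E) : Adjointable A E F →+ F :=
  AddMonoidHom.mk' (fun T => T ξ) fun S T => add_apply S T ξ

theorem continuous_eval (ξ : E) : Continuous fun T : Adjointable A E F => T ξ := by
  have := isUniformAddGroup (A := A) (E := F)
  refine continuous_of_continuousAt_zero (evalHom F ξ) ?_
  rw [ContinuousAt, map_zero, IsHilbertModule.tendsto_zero_iff (A := A)]
  intro p
  have hop := tendsto_zero_iff.1 (tendsto_id (x := 𝓝 (0 : Adjointable A E F))) p
  have hbound := ((ENNReal.tendsto_toReal ENNReal.zero_ne_top).comp hop).mul_const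
    (modNorm p.toCStarSeminorm ξ)
  rw [ENNReal.toReal_zero, zero_mul] at hbound
  refine squeeze_zero' (.of_forall fun _ => modNorm_nonneg _ _) ?_ hbound
  filter_upwards [hop.eventually (gt_mem_nhds ENNReal.zero_lt_top)] with T hT
  exact le_opNorm hT.ne ξ

theorem continuous_adj : Continuous (adj : Adjointable A E F → Adjointable A F E) :=
  continuous_of_bound (AddMonoidHom.mk' adj adj_add) fun p =>
    ⟨1, fun T => by rw [ENNReal.coe_one, one_mul]; exact opNorm_adj_le _ T⟩

instance : T2Space (Adjointable A E F) :=
  have := t2Space A F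
  T2Space.of_injective_continuous (f := fun (T : Adjointable A E F) ξ => T ξ)
    (fun _ _ h => ext (congrFun h)) (continuous_pi continuous_eval)

section Limits

variable {X : Type*} {l : Filter X} [l.NeBot] {T : X → Adjointable A E F} {t : E → F}

theorem map_rsmul_of_tendsto (ht : ∀ ξ, Tendsto (fun x => T x ξ) l (𝓝 (t ξ))) (ξ : E) (a : A) :
    t (ξ <• a) = t ξ <• a := by
  have := t2Space A F
  refine tendsto_nhds_unique (ht (ξ <• a)) ?_
  simp only [map_rsmul]
  exact ((continuous_rsmul_const a).tendsto _).comp (ht ξ)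

/-- The linear map with values the limits of the values of the `T x`. -/
def linearMapOfTendstoApply (ht : ∀ ξ, Tendsto (fun x => T x ξ) l (𝓝 (t ξ))) : E →ₗ[ℂ] F :=
  have := isUniformAddGroup (A := A) (E := F)
  have := t2Space A F
  have := continuousConstSMul A F
  linearMapOfTendsto t (fun x => (T x).1) (tendsto_pi_nhds.2 ht)

theorem exists_of_tendsto_apply (ht : ∀ ξ, Tendsto (fun x => T x ξ) l (𝓝 (t ξ))) {s : F → E}
    (hs : ∀ η, Tendsto (fun x => (T x).adj η) l (𝓝 (s η))) :
    ∃ T₀ : Adjointable A E F, ∀ ξ, T₀ ξ = t ξ := by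
  refine ⟨⟨linearMapOfTendstoApply ht, map_rsmul_of_tendsto ht, linearMapOfTendstoApply hs,
    map_rsmul_of_tendsto hs, fun ξ η => ?_⟩, fun _ => rfl⟩
  refine tendsto_nhds_unique (((continuous_inner_left (A := A) η).tendsto _).comp (ht ξ)) ?_
  simp only [Function.comp_def, inner_apply_left]
  exact ((continuous_inner_right (A := A) ξ).tendsto _).comp (hs η)

theorem opNorm_sub_le_of_tendsto_apply {T₀ : Adjointable A E F}
    (hT : ∀ ξ, Tendsto (fun x => T x ξ) l (𝓝 (T₀ ξ))) (p : ContCStarSeminorm A)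
    {S : Adjointable A E F} {C : ENNReal}
    (hC : ∀ᶠ x in l, opNorm p.toCStarSeminorm (T x - S) ≤ C) :
    opNorm p.toCStarSeminorm (T₀ - S) ≤ C := by
  have := isUniformAddGroup (A := A) (E := F)
  refine iSup₂_le fun ξ hξ => ?_
  have hlim : Tendsto (fun x => ENNReal.ofReal (modNorm p.toCStarSeminorm (T x ξ - S ξ))) l
      (𝓝 (ENNReal.ofReal (modNorm p.toCStarSeminorm (T₀ ξ - S ξ)))) :=
    (ENNReal.continuous_ofReal.tendsto _).comp
      (((continuous_modNorm p).tendsto _).comp ((hT ξ).sub_const (S ξ)))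
  refine le_of_tendsto hlim ?_
  filter_upwards [hC] with x hx
  exact (ofReal_modNorm_le_opNorm (T x - S) hξ).trans hx

end Limits

theorem le_nhds_of_cauchy_of_tendsto_apply {f : Filter (Adjointable A E F)} (hf : Cauchy f)
    {T₀ : Adjointable A E F} (hT : ∀ ξ, Tendsto (fun T : Adjointable A E F => T ξ) f (𝓝 (T₀ ξ))) :
    f ≤ 𝓝 T₀ := by
  have := hf.1
  change Tendsto id f (𝓝 T₀)
  rw [← tendsto_sub_nhds_zero_iff, tendsto_zero_iff]
  intro p
  have hdiff : Tendsto (fun x : Adjointable A E F × Adjointable A E F => x.2 - x.1)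
      (f ×ˢ f) (𝓝 0) := by
    have := hf.2
    rwa [uniformity_eq_comap_nhds_zero, ← tendsto_iff_comap] at this
  refine ENNReal.tendsto_nhds_zero.2 fun ε hε => ?_
  filter_upwards [((ENNReal.tendsto_nhds_zero.1 (tendsto_zero_iff.1 hdiff p)) ε hε).curry]
    with S hS
  rw [id, ← opNorm_neg, neg_sub]
  exact opNorm_sub_le_of_tendsto_apply hT p hS

instance : CompleteSpace (Adjointable A E F) := by
  have := isUniformAddGroup (A := A) (E := E)
  have := isUniformAddGroup (A := A) (E := F)
  have := completeSpace (A := A) (E := E)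
  have := completeSpace (A := A) (E := F)
  refine ⟨fun {f} hf => ?_⟩
  have := hf.1
  have hlim (ξ : E) : ∃ η : F, Tendsto (fun T : Adjointable A E F => T ξ) f (𝓝 η) :=
    CompleteSpace.complete (hf.map
      (uniformContinuous_addMonoidHom_of_continuous (f := evalHom F ξ) (continuous_eval ξ)))
  have hlim_adj (η : F) : ∃ ξ : E, Tendsto (fun T : Adjointable A E F => T.adj η) f (𝓝 ξ) :=
    CompleteSpace.complete (hf.map (uniformContinuous_addMonoidHom_of_continuous
      (f := (evalHom E η).comp (AddMonoidHom.mk' (adj (A := A) (E := E) (F := F)) adj_add))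
      ((continuous_eval η).comp continuous_adj)))
  choose t ht using hlim
  choose s hs using hlim_adj
  obtain ⟨T₀, hT₀⟩ := exists_of_tendsto_apply ht hs
  exact ⟨T₀, le_nhds_of_cauchy_of_tendsto_apply hf fun ξ => by rw [hT₀]; exact ht ξ⟩

end Adjointable

section PowerTrick

theorem pow_two_pow_le_of_sq_le {y : ℕ → ℝ} (hy : ∀ n, 0 ≤ y n) (h : ∀ n, y n ^ 2 ≤ y (n + 1))
    (n : ℕ) : y 0 ^ 2 ^ n ≤ y n := by
  induction n with
  | zero => simp
  | succ n ih =>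
    rw [pow_succ 2, pow_mul]
    exact (pow_le_pow_left₀ (pow_nonneg (hy 0) _) ih 2).trans (h n)

theorem le_of_forall_pow_two_pow_le {a r D : ℝ} (hr : 0 ≤ r)
    (h : ∀ n : ℕ, a ^ 2 ^ n ≤ D * r ^ 2 ^ n) : a ≤ r := by
  by_contra! hlt
  rcases hr.eq_or_lt with rfl | hr
  · have := h 0
    simp only [pow_zero, pow_one, mul_zero] at this
    linarith
  have hone := (one_lt_div hr).2 hlt
  obtain ⟨m, hm⟩ := pow_unbounded_of_one_lt D hone
  have hpow := h m
  rw [← div_le_iff₀ (by positivity), ← div_pow] at hpow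
  linarith [pow_le_pow_right₀ hone.le (Nat.lt_two_pow_self (n := m)).le]

theorem le_mul_of_sq_le_mul_of_le_pow {x : ℕ → ℝ} {t r D : ℝ} (hx : ∀ n, 0 ≤ x n) (ht : 0 ≤ t)
    (hr : 0 ≤ r) (h : ∀ n, x n ^ 2 ≤ t * x (n + 1)) (hD : ∀ n, x n ≤ D * r ^ 2 ^ n) :
    x 0 ≤ r * t := by
  rcases ht.eq_or_lt with rfl | ht
  · nlinarith [h 0, hx 0]
  have hgrowth := pow_two_pow_le_of_sq_le (y := fun n => x n / t)
    (fun n => div_nonneg (hx n) ht.le) fun n => by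
      rw [div_pow, sq t, ← div_div, div_le_div_iff_of_pos_right ht, div_le_iff₀' ht]
      exact h n
  rw [← div_le_iff₀ ht]
  refine le_of_forall_pow_two_pow_le (D := D / t) hr fun n => (hgrowth n).trans ?_
  rw [div_mul_eq_mul_div]
  exact div_le_div_of_nonneg_right (hD n) ht.le

variable {B : Type*} [NonUnitalRing B] [StarRing B]

theorem isSelfAdjoint_iterate_mul_self {b : B} (hb : IsSelfAdjoint b) (n : ℕ) :
    IsSelfAdjoint ((fun x => x * x)^[n] b) := by
  induction n with
  | zero => exact hb
  | succ n ih =>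
    rw [Function.iterate_succ_apply', IsSelfAdjoint, star_mul, ih.star_eq]

theorem CStarSeminorm.iterate_mul_self [Module ℂ B] (p : CStarSeminorm B) {b : B}
    (hb : IsSelfAdjoint b) (n : ℕ) : p ((fun x => x * x)^[n] b) = p b ^ 2 ^ n := by
  induction n with
  | zero => simp
  | succ n ih =>
    have hsq := p.star_mul_self' ((fun x => x * x)^[n] b)
    rw [(isSelfAdjoint_iterate_mul_self hb n).star_eq, ih] at hsq
    rw [Function.iterate_succ_apply', hsq, ← pow_mul, ← pow_succ]

end PowerTrick

namespace CompactOp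

open IsHilbertModule Adjointable

variable {A E F F' : Type*} [NonUnitalRing A] [StarRing A] [Module ℂ A] [UniformSpace A]
  [IsLocallyCStarAlgebra A]
  [AddCommGroup E] [Module ℂ E] [SMul Aᵐᵒᵖ E] [Inner A E] [UniformSpace E] [IsHilbertModule A E]
  [AddCommGroup F] [Module ℂ F] [SMul Aᵐᵒᵖ F] [Inner A F] [UniformSpace F] [IsHilbertModule A F]
  [AddCommGroup F'] [Module ℂ F'] [SMul Aᵐᵒᵖ F'] [Inner A F'] [UniformSpace F']
  [IsHilbertModule A F']

instance : IsUniformAddGroup (CompactOp A E F) :=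
  inferInstanceAs (IsUniformAddGroup (compacts A E F).toAddSubgroup)

instance : CompleteSpace (CompactOp A E F) :=
  (Submodule.isClosed_topologicalClosure (finiteRank A E F)).completeSpace_coe

/-- The operator seminorm on `K(E, F)`, which is finite there. -/
def knorm (p : ContCStarSeminorm A) (T : CompactOp A E F) : ℝ :=
  (opNorm p.toCStarSeminorm T.1).toReal

theorem knorm_nonneg (p : ContCStarSeminorm A) (T : CompactOp A E F) : 0 ≤ knorm p T :=
  ENNReal.toReal_nonneg

theorem ofReal_knorm (p : ContCStarSeminorm A) (T : CompactOp A E F) :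
    ENNReal.ofReal (knorm p T) = opNorm p.toCStarSeminorm T.1 :=
  ENNReal.ofReal_toReal (opNorm_ne_top p T.2)

theorem le_knorm (p : ContCStarSeminorm A) (T : CompactOp A E F) (ξ : E) :
    modNorm p.toCStarSeminorm (T.1 ξ) ≤ knorm p T * modNorm p.toCStarSeminorm ξ :=
  le_opNorm (opNorm_ne_top p T.2) ξ

theorem knorm_le {p : ContCStarSeminorm A} {T : CompactOp A E F} {C : ℝ} (hC : 0 ≤ C)
    (h : ∀ ξ, modNorm p.toCStarSeminorm (T.1 ξ) ≤ C * modNorm p.toCStarSeminorm ξ) :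
    knorm p T ≤ C :=
  ENNReal.toReal_le_of_le_ofReal hC (opNorm_le hC h)

theorem knorm_add_le (p : ContCStarSeminorm A) (S T : CompactOp A E F) :
    knorm p (S + T) ≤ knorm p S + knorm p T :=
  knorm_le (add_nonneg (knorm_nonneg p S) (knorm_nonneg p T)) fun ξ => by
    rw [add_mul]
    exact (modNorm_add_le _ _ _).trans (add_le_add (le_knorm p S ξ) (le_knorm p T ξ))

theorem knorm_smul_le (p : ContCStarSeminorm A) (c : ℂ) (T : CompactOp A E F) :
    knorm p (c • T) ≤ ‖c‖ * knorm p T :=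
  knorm_le (mul_nonneg (norm_nonneg c) (knorm_nonneg p T)) fun ξ => by
    rw [mul_assoc]
    exact (modNorm_smul _ _ _).trans_le
      (mul_le_mul_of_nonneg_left (le_knorm p T ξ) (norm_nonneg c))

theorem knorm_comp_le (p : ContCStarSeminorm A) (S : CompactOp A F F') (T : CompactOp A E F) :
    knorm p (S.comp T) ≤ knorm p S * knorm p T :=
  knorm_le (mul_nonneg (knorm_nonneg p S) (knorm_nonneg p T)) fun ξ => by
    rw [mul_assoc]
    exact (le_knorm p S (T.1 ξ)).trans
      (mul_le_mul_of_nonneg_left (le_knorm p T ξ) (knorm_nonneg p S))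

theorem knorm_adj (p : ContCStarSeminorm A) (T : CompactOp A E F) : knorm p T.adj = knorm p T :=
  congrArg ENNReal.toReal (opNorm_adj _ _)

theorem modNorm_apply_sq_le (p : CStarSeminorm A) (T : CompactOp A E F) (ξ : E) :
    modNorm p (T.1 ξ) ^ 2 ≤ modNorm p ξ * modNorm p ((T.adj.comp T).1 ξ) := by
  rw [modNorm_sq, inner_apply_left]
  exact cauchy_schwarz _ _ _

theorem knorm_adj_comp_self (p : ContCStarSeminorm A) (T : CompactOp A E F) :
    knorm p (T.adj.comp T) = knorm p T ^ 2 := by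
  refine le_antisymm ((knorm_comp_le p _ _).trans_eq (by rw [knorm_adj, sq])) ?_
  refine (Real.le_sqrt (knorm_nonneg p T) (knorm_nonneg p _)).1 ?_
  refine knorm_le (Real.sqrt_nonneg _) fun ξ => ?_
  refine abs_le_of_sq_le_sq' ?_ (mul_nonneg (Real.sqrt_nonneg _) (modNorm_nonneg _ _)) |>.2
  calc modNorm p.toCStarSeminorm (T.1 ξ) ^ 2
      ≤ modNorm p.toCStarSeminorm ξ * modNorm p.toCStarSeminorm ((T.adj.comp T).1 ξ) :=
        modNorm_apply_sq_le _ T ξ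
    _ ≤ modNorm p.toCStarSeminorm ξ *
          (knorm p (T.adj.comp T) * modNorm p.toCStarSeminorm ξ) :=
        mul_le_mul_of_nonneg_left (le_knorm p _ ξ) (modNorm_nonneg _ _)
    _ = (√(knorm p (T.adj.comp T)) * modNorm p.toCStarSeminorm ξ) ^ 2 := by
        rw [mul_pow, Real.sq_sqrt (knorm_nonneg _ _)]
        ring

variable (E F) in
/-- The operator seminorm of `K(E, F)`, bundled as a seminorm. -/
def kSeminorm (p : ContCStarSeminorm A) : Seminorm ℂ (CompactOp A E F) :=
  Seminorm.ofSMulLE (knorm p)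
    ((knorm_le le_rfl fun ξ => by
      rw [zero_mul]
      exact (modNorm_zero _).le).antisymm (knorm_nonneg _ _))
    (knorm_add_le p) (knorm_smul_le p)

theorem comap_opNorm_eq_comap_knorm (p : ContCStarSeminorm A) :
    comap (fun T : CompactOp A E F => opNorm p.toCStarSeminorm T.1) (𝓝 0) =
      comap (knorm p) (𝓝 0) := by
  refine le_antisymm ?_ ?_
  · rw [← tendsto_iff_comap]
    exact (ENNReal.tendsto_toReal ENNReal.zero_ne_top).comp tendsto_comap
  · rw [← tendsto_iff_comap]
    simpa only [Function.comp_def, ofReal_knorm, ENNReal.ofReal_zero] using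
      (ENNReal.continuous_ofReal.tendsto 0).comp
        (tendsto_comap (f := (knorm p : CompactOp A E F → ℝ)))

variable (A E F) in
theorem withSeminorms : WithSeminorms (kSeminorm (A := A) E F) := by
  refine (SeminormFamily.withSeminorms_iff_nhds_eq_iInf _).2 ?_
  rw [nhds_subtype_eq_comap]
  change comap _ (𝓝 (0 : Adjointable A E F)) = _
  rw [Adjointable.nhds_zero_eq, Filter.comap_iInf]
  exact iInf_congr fun p => Filter.comap_comap.trans (comap_opNorm_eq_comap_knorm p)

variable (E) in
/-- The C⋆-seminorm on `K(E)` attached to a continuous C⋆-seminorm on `A`. -/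
def kCStarSeminorm (p : ContCStarSeminorm A) : ContCStarSeminorm (CompactOp A E E) where
  __ := kSeminorm E E p
  mul_le := knorm_comp_le p
  star_mul_self := knorm_adj_comp_self p
  continuous_toFun := (withSeminorms A E E).continuous_seminorm p

instance : IsLocallyCStarAlgebra (CompactOp A E E) where
  __ := (inferInstance : IsUniformAddGroup (CompactOp A E E))
  smul_assoc _ _ _ := ext fun _ => rfl
  smul_comm c S T := ext fun ξ => (S.1.map_smul c (T.1 ξ)).symm
  star_smul c T := Subtype.ext (adj_smul c T.1)
  nhds_zero := by
    refine le_antisymm (le_iInf fun q => ?_) ?_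
    · rw [← tendsto_iff_comap]
      have h := q.continuous_toFun.tendsto 0
      rwa [show q.toFun 0 = 0 from _root_.map_zero q.toSeminorm] at h
    · rw [(SeminormFamily.withSeminorms_iff_nhds_eq_iInf _).1 (withSeminorms A E E)]
      exact le_iInf fun p => iInf_le _ (kCStarSeminorm E p)

theorem modNorm_kCStarSeminorm (p : ContCStarSeminorm A) (T : CompactOp A E A) :
    modNorm (kCStarSeminorm E p).toCStarSeminorm T = knorm p T := by
  change √(knorm p (T.adj.comp T)) = _
  rw [knorm_adj_comp_self, Real.sqrt_sq (knorm_nonneg p T)]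

theorem star_adj_comp_self (T : CompactOp A E F) : star (T.adj.comp T) = T.adj.comp T :=
  Subtype.ext ((Adjointable.adj_comp T.1.adj T.1).trans (by rw [Adjointable.adj_adj]; rfl))

-- Squaring `S` repeatedly makes the constant `C` disappear, as in the spectral radius formula.
theorem knorm_le_knorm_of_isSelfAdjoint {p q : ContCStarSeminorm A} {C : ℝ}
    (h : ∀ ξ : E, modNorm p.toCStarSeminorm ξ ≤ C * modNorm q.toCStarSeminorm ξ)
    {S : CompactOp A E E} (hS : IsSelfAdjoint S) : knorm p S ≤ knorm q S := by
  have hC (ξ : E) : modNorm p.toCStarSeminorm ξ ≤ |C| * modNorm q.toCStarSeminorm ξ :=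
    (h ξ).trans (mul_le_mul_of_nonneg_right (le_abs_self C) (modNorm_nonneg _ _))
  refine knorm_le (knorm_nonneg _ _) fun ξ => ?_
  refine le_mul_of_sq_le_mul_of_le_pow (D := |C| * modNorm q.toCStarSeminorm ξ)
    (x := fun n => modNorm p.toCStarSeminorm (((fun T => T * T)^[n] S).1 ξ))
    (fun n => modNorm_nonneg _ _) (modNorm_nonneg _ _) (knorm_nonneg _ _) (fun n => ?_) fun n => ?_
  · have hsq := modNorm_apply_sq_le p.toCStarSeminorm ((fun T => T * T)^[n] S) ξ
    rw [show adj _ = _ from (isSelfAdjoint_iterate_mul_self hS n).star_eq] at hsq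
    rw [Function.iterate_succ_apply']
    exact hsq
  · calc modNorm p.toCStarSeminorm (((fun T => T * T)^[n] S).1 ξ)
        ≤ |C| * modNorm q.toCStarSeminorm (((fun T => T * T)^[n] S).1 ξ) := hC _
      _ ≤ |C| * (knorm q ((fun T => T * T)^[n] S) * modNorm q.toCStarSeminorm ξ) :=
        mul_le_mul_of_nonneg_left (le_knorm q _ ξ) (abs_nonneg C)
      _ = |C| * modNorm q.toCStarSeminorm ξ * knorm q S ^ 2 ^ n := by
        rw [show knorm q _ = knorm q S ^ 2 ^ n from (kCStarSeminorm E q).iterate_mul_self hS n]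
        ring

theorem knorm_le_knorm {p q : ContCStarSeminorm A} {C : ℝ}
    (h : ∀ ξ : E, modNorm p.toCStarSeminorm ξ ≤ C * modNorm q.toCStarSeminorm ξ)
    (T : CompactOp A E F) : knorm p T ≤ knorm q T := by
  have hle := knorm_le_knorm_of_isSelfAdjoint h (star_adj_comp_self T)
  rw [knorm_adj_comp_self, knorm_adj_comp_self] at hle
  exact abs_le_of_sq_le_sq' hle (knorm_nonneg _ _) |>.2

end CompactOp

section CStar

variable {B C : Type*} [NonUnitalCStarAlgebra B] [PartialOrder B] [StarOrderedRing B]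
  [NonUnitalCStarAlgebra C] [PartialOrder C] [StarOrderedRing C]

-- Test the inequality at `b = y⁻` and `c = √y⁻ y⁻`, where the sum on the right-hand side vanishes.
theorem nonneg_of_forall_norm_le {y : B} (hy : IsSelfAdjoint y)
    (h : ∀ b c : B, ‖star c * c‖ ≤ ‖star b * (y * b) + star c * c‖) : 0 ≤ y := by
  rw [← CFC.negPart_eq_zero_iff y hy]
  set n := y⁻ with hn
  have hn_nonneg : 0 ≤ n := CFC.negPart_nonneg y
  have hn_star : star n = n := hn_nonneg.isSelfAdjoint
  have hyn : y * n = -(n * n) := by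
    conv_lhs => rw [← CFC.posPart_sub_negPart y hy, sub_mul, hn, CFC.posPart_mul_negPart, zero_sub]
  have hc : star (CFC.sqrt n * n) * (CFC.sqrt n * n) = n * (n * n) := by
    rw [star_mul, hn_star, (CFC.sqrt_nonneg n).isSelfAdjoint.star_eq, mul_assoc,
      ← mul_assoc (CFC.sqrt n), CFC.sqrt_mul_sqrt_self n hn_nonneg]
  have hcube : n * (n * n) = 0 := by
    simpa only [hc, hn_star, hyn, mul_neg, neg_add_cancel, norm_zero, norm_le_zero_iff]
      using h n (CFC.sqrt n * n)
  have hsq : n * n = 0 := by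
    rw [← CStarRing.star_mul_self_eq_zero_iff, star_mul, hn_star, mul_assoc, hcube, mul_zero]
  rw [← CStarRing.star_mul_self_eq_zero_iff, hn_star, hsq]

theorem map_sqrt (φ : B →⋆ₙₐ[ℂ] C) {b : B} (hb : 0 ≤ b) : φ (CFC.sqrt b) = CFC.sqrt (φ b) :=
  (CFC.sqrt_unique (by rw [← map_mul, CFC.sqrt_mul_sqrt_self b hb])
    (map_nonneg φ (CFC.sqrt_nonneg b))).symm

end CStar

section InverseLimit

variable {Λ X : Type*} {Y : Λ → Type*}

theorem isUniformInducing_pi_of_withSeminorms [AddCommGroup X] [Module ℂ X] [UniformSpace X]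
    [IsUniformAddGroup X] [∀ i, SeminormedAddCommGroup (Y i)] {p : SeminormFamily ℂ X Λ}
    (hp : WithSeminorms p) (f : ∀ i, X →+ Y i) (hf : ∀ i x, ‖f i x‖ = p i x) :
    IsUniformInducing fun x i => f i x := by
  refine AddMonoidHom.isUniformInducing_of_isInducing (f := AddMonoidHom.pi f) ?_
  rw [IsTopologicalAddGroup.isInducing_iff_nhds_zero, p.withSeminorms_iff_nhds_eq_iInf.1 hp,
    nhds_pi, Filter.pi, Filter.comap_iInf]
  refine iInf_congr fun i => ?_
  rw [Filter.comap_comap, Pi.zero_apply, ← comap_norm_nhds_zero (E := Y i), Filter.comap_comap]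
  exact congrArg (Filter.comap · _) (funext fun x => (hf i x).symm)

variable [Preorder Λ] [IsDirectedOrder Λ] [Nonempty X] {f : ∀ i, X → Y i}
  {t : ∀ {i j : Λ}, i ≤ j → Y j → Y i} {y : ∀ i, Y i}

theorem mem_closure_range_of_coherent [∀ i, TopologicalSpace (Y i)]
    (hd : ∀ i, DenseRange (f i)) (ht : ∀ {i j} (hij : i ≤ j), Continuous (t hij))
    (htf : ∀ {i j} (hij : i ≤ j) x, t hij (f j x) = f i x)
    (hy : ∀ i j (hij : i ≤ j), t hij (y j) = y i) : y ∈ closure (Set.range fun x i => f i x) := by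
  have hmono {i j} (hij : i ≤ j) : comap (f j) (𝓝 (y j)) ≤ comap (f i) (𝓝 (y i)) := by
    rw [← tendsto_iff_comap, ← hy i j hij, ← show t hij ∘ f j = f i from funext (htf hij)]
    exact ((ht hij).tendsto (y j)).comp tendsto_comap
  have hne : (⨅ i, comap (f i) (𝓝 (y i))).NeBot :=
    iInf_neBot_of_directed (fun i j =>
      let ⟨k, hik, hjk⟩ := exists_ge_ge i j
      ⟨k, hmono hik, hmono hjk⟩) fun i => comap_neBot fun _ => (hd i).mem_nhds
  refine mem_closure_of_tendsto (b := ⨅ i, comap (f i) (𝓝 (y i))) (tendsto_pi_nhds.2 fun i => ?_)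
    (.of_forall Set.mem_range_self)
  exact tendsto_iff_comap.2 (iInf_le _ i)

theorem existsUnique_of_coherent [UniformSpace X] [CompleteSpace X] [T0Space X]
    [∀ i, UniformSpace (Y i)] [∀ i, T0Space (Y i)] (hf : IsUniformInducing fun x i => f i x)
    (hd : ∀ i, DenseRange (f i)) (ht : ∀ {i j} (hij : i ≤ j), Continuous (t hij))
    (htf : ∀ {i j} (hij : i ≤ j) x, t hij (f j x) = f i x)
    (hy : ∀ i j (hij : i ≤ j), t hij (y j) = y i) : ∃! x, ∀ i, f i x = y i := by
  have hclosed : IsClosed (Set.range fun x i => f i x) :=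
    ((completeSpace_iff_isComplete_range hf).1 inferInstance).isClosed
  obtain ⟨x, rfl⟩ := hclosed.closure_eq ▸ mem_closure_range_of_coherent hd ht htf hy
  exact ⟨x, fun _ => rfl, fun x' hx' => hf.isInducing.injective (funext hx')⟩

end InverseLimit

namespace CStarSeminorm

variable {A B : Type*} [NonUnitalRing A] [StarRing A] [Module ℂ A]
  [NonUnitalRing B] [StarRing B] [Module ℂ B]

/-- The canonical map of `A` into its completion with respect to `p`. -/
def toComplHom (p : CStarSeminorm A) : A →⋆ₙₐ[ℂ] p.Compl where
  toFun a := ((show p.WithSeminorm from a : p.WithSeminorm) : p.Compl)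
  map_smul' c a := Completion.coe_smul c (show p.WithSeminorm from a)
  map_zero' := Completion.coe_zero
  map_add' a b := Completion.coe_add (show p.WithSeminorm from a) b
  map_mul' a b := p.coe_mul_compl a b
  map_star' a := p.coe_star_compl a

theorem norm_toComplHom (p : CStarSeminorm A) (a : A) : ‖p.toComplHom a‖ = p a :=
  Completion.norm_coe (show p.WithSeminorm from a)

theorem denseRange_toComplHom (p : CStarSeminorm A) : DenseRange p.toComplHom :=
  Completion.denseRange_coe (α := p.WithSeminorm)

section Map

variable {p : CStarSeminorm A} {q : CStarSeminorm B} (f : A →⋆ₙₐ[ℂ] B)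

variable (p q) in
/-- The linear map underlying `complMap`; zero if `f` is not bounded. -/
def complMapCLM : p.Compl →L[ℂ] q.Compl :=
  (q.toComplHom.comp f : A →ₗ[ℂ] q.Compl).extendOfNorm (p.toComplHom : A →ₗ[ℂ] p.Compl)

variable {f} (hf : ∀ a, q (f a) ≤ p a)

include hf in
theorem norm_comp_le (a : A) : ‖q.toComplHom (f a)‖ ≤ 1 * ‖p.toComplHom a‖ := by
  rw [norm_toComplHom, norm_toComplHom, one_mul]
  exact hf a

include hf in
theorem complMapCLM_coe (a : A) : complMapCLM p q f (p.toComplHom a) = q.toComplHom (f a) :=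
  LinearMap.extendOfNorm_eq (f := (q.toComplHom.comp f : A →ₗ[ℂ] q.Compl))
    (e := (p.toComplHom : A →ₗ[ℂ] p.Compl)) p.denseRange_toComplHom ⟨1, norm_comp_le hf⟩ a

/-- The extension of a contractive morphism to the completions. -/
def complMap : p.Compl →⋆ₙₐ[ℂ] q.Compl where
  __ := complMapCLM p q f
  map_zero' := map_zero (complMapCLM p q f)
  map_mul' x y := p.denseRange_toComplHom.induction_on₂ (p := fun x y =>
      complMapCLM p q f (x * y) = complMapCLM p q f x * complMapCLM p q f y)
    (isClosed_eq (by fun_prop) (by fun_prop))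
    (fun a b => by rw [← map_mul, complMapCLM_coe hf, complMapCLM_coe hf, complMapCLM_coe hf,
      map_mul, map_mul]) x y
  map_star' x := p.denseRange_toComplHom.induction_on (p := fun x =>
      complMapCLM p q f (star x) = star (complMapCLM p q f x)) x
    (isClosed_eq (by fun_prop) (by fun_prop))
    fun a => by rw [← map_star, complMapCLM_coe hf, complMapCLM_coe hf, map_star, map_star]

theorem continuous_complMap : Continuous (complMap hf) := (complMapCLM p q f).continuous

theorem complMap_coe (a : A) : complMap hf (p.toComplHom a) = q.toComplHom (f a) :=
  complMapCLM_coe hf a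

end Map

/-- The map between the completions of `A` with respect to comparable C⋆-seminorms. -/
def complOfLE {p q : CStarSeminorm A} (h : ∀ a, q a ≤ p a) : p.Compl →⋆ₙₐ[ℂ] q.Compl :=
  complMap (f := .id ℂ A) h

theorem continuous_complOfLE {p q : CStarSeminorm A} (h : ∀ a, q a ≤ p a) :
    Continuous (complOfLE h) :=
  continuous_complMap (f := .id ℂ A) h

theorem complOfLE_coe {p q : CStarSeminorm A} (h : ∀ a, q a ≤ p a) (a : A) :
    complOfLE h (p.toComplHom a) = q.toComplHom a :=
  complMap_coe (f := .id ℂ A) h a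

theorem exists_toComplHom_eq_star_mul_self [IsScalarTower ℂ A A] [SMulCommClass ℂ A A]
    [StarModule ℂ A] (p : CStarSeminorm A) {y : A} (hy : IsSelfAdjoint y)
    (h : ∀ b c : A, p (star c * c) ≤ p (star b * (y * b) + star c * c)) :
    ∃ b : p.Compl, p.toComplHom y = star b * b := by
  let _ := CStarAlgebra.spectralOrder p.Compl
  have := CStarAlgebra.spectralOrderedRing p.Compl
  refine CStarAlgebra.nonneg_iff_eq_star_mul_self.1
    (nonneg_of_forall_norm_le (hy.map p.toComplHom) fun b c => ?_)
  refine p.denseRange_toComplHom.induction_on₂ (p := fun b c =>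
    ‖star c * c‖ ≤ ‖star b * (p.toComplHom y * b) + star c * c‖)
    (isClosed_le (by fun_prop) (by fun_prop)) (fun b c => ?_) b c
  simp only [← map_star, ← map_mul, ← map_add, norm_toComplHom]
  exact h b c

end CStarSeminorm

namespace IsLocallyCStarAlgebra

open CStarSeminorm

variable {A : Type*} [NonUnitalRing A] [StarRing A] [Module ℂ A] [UniformSpace A]
  [IsLocallyCStarAlgebra A] {Λ : Type*} {r : Λ → ContCStarSeminorm A}

theorem isUniformInducing_toComplHom (hgen : WithSeminorms fun i => (r i).toSeminorm) :
    IsUniformInducing fun (a : A) i => (r i).toComplHom a :=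
  isUniformInducing_pi_of_withSeminorms hgen (fun i => ((r i).toComplHom : A →+ (r i).Compl))
    fun i => (r i).norm_toComplHom

variable [Preorder Λ] [IsDirectedOrder Λ]

theorem existsUnique_toComplHom_eq (hgen : WithSeminorms fun i => (r i).toSeminorm)
    (hr : ∀ {i j}, i ≤ j → ∀ a, (r i).toCStarSeminorm a ≤ (r j).toCStarSeminorm a)
    (x : ∀ i, (r i).Compl)
    (hx : ∀ i j (hij : i ≤ j), complOfLE (hr hij) (x j) = x i) :
    ∃! a : A, ∀ i, (r i).toComplHom a = x i :=
  existsUnique_of_coherent (t := fun hij => complOfLE (hr hij))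
    (isUniformInducing_toComplHom hgen) (fun i => (r i).denseRange_toComplHom)
    (fun hij => continuous_complOfLE (hr hij)) (fun hij => complOfLE_coe (hr hij)) hx

theorem exists_eq_star_mul_self (hgen : WithSeminorms fun i => (r i).toSeminorm)
    (hr : ∀ {i j}, i ≤ j → ∀ a, (r i).toCStarSeminorm a ≤ (r j).toCStarSeminorm a) {x : A}
    (hx : ∀ i, ∃ b, (r i).toComplHom x = star b * b) : ∃ b, x = star b * b := by
  let _ (i) := CStarAlgebra.spectralOrder (r i).Compl
  have := fun i => CStarAlgebra.spectralOrderedRing (r i).Compl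
  have hx_nonneg (i) : 0 ≤ (r i).toComplHom x :=
    CStarAlgebra.nonneg_iff_eq_star_mul_self.2 (hx i)
  obtain ⟨b, hb, -⟩ := existsUnique_toComplHom_eq hgen hr
    (fun i => CFC.sqrt ((r i).toComplHom x)) fun i j hij => by
      rw [map_sqrt _ (hx_nonneg j), complOfLE_coe]
  refine ⟨b, (isUniformInducing_toComplHom hgen).isInducing.injective (funext fun i => ?_)⟩
  simp only [map_mul, map_star, hb, (CFC.sqrt_nonneg ((r i).toComplHom x)).isSelfAdjoint.star_eq,
    CFC.sqrt_mul_sqrt_self _ (hx_nonneg i)]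

end IsLocallyCStarAlgebra

namespace ContCStarSeminorm

section Order

variable {A : Type*} [NonUnitalRing A] [StarRing A] [Module ℂ A] [TopologicalSpace A]

instance : Preorder (ContCStarSeminorm A) :=
  Preorder.lift fun p => (p.toCStarSeminorm : A → ℝ)

instance : Max (ContCStarSeminorm A) :=
  ⟨fun p q =>
    { p.toSeminorm ⊔ q.toSeminorm with
      mul_le := fun a b => max_le
        ((p.mul_le' a b).trans (mul_le_mul (le_max_left _ _) (le_max_left _ _) (p.nonneg _)
          ((p.nonneg a).trans (le_max_left _ _))))
        ((q.mul_le' a b).trans (mul_le_mul (le_max_right _ _) (le_max_right _ _) (q.nonneg _)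
          ((p.nonneg a).trans (le_max_left _ _))))
      star_mul_self := fun a => by
        change max (p.toCStarSeminorm (star a * a)) (q.toCStarSeminorm (star a * a)) =
          (max (p.toCStarSeminorm a) (q.toCStarSeminorm a)) ^ 2
        rw [p.star_mul_self', q.star_mul_self']
        rcases le_total (p.toCStarSeminorm a) (q.toCStarSeminorm a) with h | h
        · rw [max_eq_right h, max_eq_right (pow_le_pow_left₀ (p.nonneg a) h 2)]
        · rw [max_eq_left h, max_eq_left (pow_le_pow_left₀ (q.nonneg a) h 2)]
      continuous_toFun := p.continuous_toFun.max q.continuous_toFun }⟩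

theorem max_apply (p q : ContCStarSeminorm A) (a : A) :
    (p ⊔ q).toCStarSeminorm a = max (p.toCStarSeminorm a) (q.toCStarSeminorm a) := rfl

instance : IsDirectedOrder (ContCStarSeminorm A) :=
  ⟨fun p q => ⟨p ⊔ q, fun _ => le_max_left _ _, fun _ => le_max_right _ _⟩⟩

end Order

section Pullback

variable {A B : Type*} [NonUnitalRing A] [StarRing A] [Module ℂ A] [TopologicalSpace A]
  [NonUnitalRing B] [StarRing B] [Module ℂ B] [TopologicalSpace B]

/-- The pull-back of a continuous C⋆-seminorm along a continuous morphism. -/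
def pullback (p : ContCStarSeminorm B) (α : A →⋆ₙₐ[ℂ] B) (hα : Continuous α) :
    ContCStarSeminorm A where
  __ := p.toSeminorm.comp (α : A →ₗ[ℂ] B)
  mul_le a b := by
    change p.toCStarSeminorm (α (a * b)) ≤ _
    rw [map_mul]
    exact p.mul_le' _ _
  star_mul_self a := by
    change p.toCStarSeminorm (α (star a * a)) = _
    rw [map_mul, map_star]
    exact p.star_mul_self' _
  continuous_toFun := p.continuous_toFun.comp hα

theorem pullback_apply (p : ContCStarSeminorm B) (α : A →⋆ₙₐ[ℂ] B) (hα : Continuous α) (a : A) :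
    (p.pullback α hα).toCStarSeminorm a = p.toCStarSeminorm (α a) := rfl

end Pullback

end ContCStarSeminorm

namespace CompactOp

open IsHilbertModule Adjointable

variable {A E F : Type*} [NonUnitalRing A] [StarRing A] [Module ℂ A] [UniformSpace A]
  [IsLocallyCStarAlgebra A]
  [AddCommGroup E] [Module ℂ E] [SMul Aᵐᵒᵖ E] [Inner A E] [UniformSpace E] [IsHilbertModule A E]
  [AddCommGroup F] [Module ℂ F] [SMul Aᵐᵒᵖ F] [Inner A F] [UniformSpace F] [IsHilbertModule A F]

theorem modNorm_apply_sq_le_of_add (p : ContCStarSeminorm A) (T : CompactOp A E F)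
    (b c : CompactOp A E E) (ξ : E) :
    modNorm p.toCStarSeminorm (c.1 ξ) ^ 2 ≤
      knorm p (star b * (T.adj.comp T * b) + star c * c) * modNorm p.toCStarSeminorm ξ ^ 2 := by
  set R := star b * (T.adj.comp T * b) + star c * c
  obtain ⟨x, hx⟩ := inner_self_pos (A := A) (c.1 ξ)
  obtain ⟨y, hy⟩ := inner_self_pos (A := A) (T.1 (b.1 ξ))
  have hR : inner A ξ (R.1 ξ) = star x * x + star y * y := by
    rw [← hx, ← hy, add_comm]
    change inner A ξ (b.1.adj (T.1.adj (T.1 (b.1 ξ))) + c.1.adj (c.1 ξ)) = _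
    rw [ip_add_right, ← inner_apply_left, ← inner_apply_left, ← inner_apply_left]
  calc modNorm p.toCStarSeminorm (c.1 ξ) ^ 2
      ≤ p.toCStarSeminorm (inner A ξ (R.1 ξ)) := by
        rw [modNorm_sq, hx, hR]
        exact p.le_add_of_star_mul_self x y
    _ ≤ modNorm p.toCStarSeminorm ξ * modNorm p.toCStarSeminorm (R.1 ξ) := cauchy_schwarz _ _ _
    _ ≤ modNorm p.toCStarSeminorm ξ * (knorm p R * modNorm p.toCStarSeminorm ξ) :=
        mul_le_mul_of_nonneg_left (le_knorm p R ξ) (modNorm_nonneg _ _)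
    _ = knorm p R * modNorm p.toCStarSeminorm ξ ^ 2 := by ring

theorem knorm_star_mul_self_le (p : ContCStarSeminorm A) (T : CompactOp A E F)
    (b c : CompactOp A E E) :
    knorm p (star c * c) ≤ knorm p (star b * (T.adj.comp T * b) + star c * c) := by
  refine (knorm_adj_comp_self p c).trans_le
    ((Real.le_sqrt (knorm_nonneg p c) (knorm_nonneg p _)).1 ?_)
  refine knorm_le (Real.sqrt_nonneg _) fun ξ => ?_
  refine abs_le_of_sq_le_sq' ?_ (mul_nonneg (Real.sqrt_nonneg _) (modNorm_nonneg _ _)) |>.2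
  rw [mul_pow, Real.sq_sqrt (knorm_nonneg _ _)]
  exact modNorm_apply_sq_le_of_add p T b c ξ

theorem knorm_mono {p q : ContCStarSeminorm A} (h : p ≤ q) (T : CompactOp A E F) :
    knorm p T ≤ knorm q T :=
  knorm_le_knorm (C := 1) (fun ξ => by rw [one_mul]; exact Real.sqrt_le_sqrt (h _)) T

theorem exists_adj_comp_self_eq (T : CompactOp A E F) :
    ∃ b : CompactOp A E E, T.adj.comp T = star b * b :=
  IsLocallyCStarAlgebra.exists_eq_star_mul_self (r := kCStarSeminorm E) (withSeminorms A E E)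
    (fun {_ _} hpq => knorm_mono hpq) fun p =>
      (kCStarSeminorm E p).exists_toComplHom_eq_star_mul_self (star_adj_comp_self T)
        (knorm_star_mul_self_le p T)

theorem eq_zero_of_adj_comp_self_eq_zero {T : CompactOp A E F} (h : T.adj.comp T = 0) :
    T = 0 := by
  refine ext fun ξ => ?_
  have hξ : T.1.adj (T.1 ξ) = 0 := congrArg (fun R : CompactOp A E E => R.1 ξ) h
  change T.1 ξ = 0
  rw [← inner_self_eq_zero (A := A), inner_apply_left, hξ]
  simpa using ip_smul_right (A := A) 0 ξ (0 : E)

theorem tendsto_adj_comp_self :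
    Tendsto (fun T : CompactOp A E F => T.adj.comp T) (𝓝 0) (𝓝 0) := by
  refine (tendsto_zero_iff_of_withSeminorms (withSeminorms A E E)).2 fun p => ?_
  have hp : Tendsto (knorm p) (𝓝 (0 : CompactOp A E F)) (𝓝 0) :=
    (tendsto_zero_iff_of_withSeminorms (withSeminorms A E F)).1 tendsto_id p
  refine Tendsto.congr (fun T => (knorm_adj_comp_self p T).symm) ?_
  simpa only [ne_eq, two_ne_zero, not_false_eq_true, zero_pow] using hp.pow 2

theorem nhds_zero_eq_iInf_comap_modNorm : 𝓝 (0 : CompactOp A E A) =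
    ⨅ q : ContCStarSeminorm (CompactOp A E E), comap (modNorm q.toCStarSeminorm) (𝓝 0) := by
  refine le_antisymm (le_iInf fun q => ?_) ?_
  · rw [← tendsto_iff_comap]
    have hq := (Real.continuous_sqrt.tendsto _).comp
      ((q.continuous_toFun.tendsto 0).comp
      (tendsto_adj_comp_self (A := A) (E := E) (F := A)))
    rwa [show q.toFun 0 = 0 from _root_.map_zero q.toSeminorm, Real.sqrt_zero] at hq
  · rw [(SeminormFamily.withSeminorms_iff_nhds_eq_iInf _).1 (withSeminorms A E A)]
    refine le_iInf fun p => (iInf_le _ (kCStarSeminorm E p)).trans_eq ?_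
    exact congrArg (Filter.comap · _) (funext (modNorm_kCStarSeminorm p))

instance : IsHilbertModule (CompactOp A E E) (CompactOp A E A) where
  isUniformAddGroup := inferInstance
  completeSpace := inferInstance
  add_rsmul _ _ _ := rfl
  rsmul_add S k l := ext fun ξ => S.1.map_add (k.1 ξ) (l.1 ξ)
  rsmul_mul _ _ _ := rfl
  smul_rsmul _ _ _ := rfl
  rsmul_smul c S k := ext fun ξ => S.1.map_smul c (k.1 ξ)
  ip_add_right S T R := ext fun ξ => S.1.adj.map_add (T.1 ξ) (R.1 ξ)
  ip_smul_right c S T := ext fun ξ => S.1.adj.map_smul c (T.1 ξ)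
  inner_rsmul_right _ _ _ := rfl
  star_inner S T := Subtype.ext
    ((Adjointable.adj_comp S.1.adj T.1).trans (by rw [Adjointable.adj_adj]; rfl))
  inner_self_pos := exists_adj_comp_self_eq
  inner_self_eq_zero T := ⟨eq_zero_of_adj_comp_self_eq_zero, by
    rintro rfl
    exact ext fun _ => (0 : CompactOp A E A).1.adj.1.map_zero⟩
  nhds_zero := nhds_zero_eq_iInf_comap_modNorm

end CompactOp

section Covariant

variable {A B E F : Type*} [NonUnitalRing A] [StarRing A] [Module ℂ A]
  [NonUnitalRing B] [StarRing B] [Module ℂ B] [Inner A E] [Inner B F]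

/-- A map from an `A`-module to a `B`-module whose effect on inner products is given by the
morphism `α`. -/
def IsCovariant (α : A →⋆ₙₐ[ℂ] B) (u : E → F) : Prop :=
  ∀ ξ η : E, inner B (u ξ) (u η) = α (inner A ξ η)

theorem IsCovariant.modNorm_apply_le {α : A →⋆ₙₐ[ℂ] B} {u : E → F} (h : IsCovariant α u)
    {p : CStarSeminorm A} {q : CStarSeminorm B} (hα : ∀ a, q (α a) ≤ p a) (ξ : E) :
    modNorm q (u ξ) ≤ modNorm p ξ := by
  rw [modNorm, h, modNorm]
  exact Real.sqrt_le_sqrt (hα _)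

variable [TopologicalSpace A] [TopologicalSpace B]

theorem IsCovariant.modNorm_apply {α : A →⋆ₙₐ[ℂ] B} {u : E → F} (h : IsCovariant α u)
    (hα : Continuous α) (p : ContCStarSeminorm B) (ξ : E) :
    modNorm p.toCStarSeminorm (u ξ) = modNorm (p.pullback α hα).toCStarSeminorm ξ := by
  rw [modNorm, h, modNorm, p.pullback_apply]

theorem IsFull.hom_ext [T2Space B] (hE : IsFull A E) {α β : A →⋆ₙₐ[ℂ] B} (hα : Continuous α)
    (hβ : Continuous β) (h : ∀ ξ η : E, α (inner A ξ η) = β (inner A ξ η)) (a : A) :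
    α a = β a := by
  refine congrFun (Continuous.ext_on hE hα hβ ?_) a
  refine LinearMap.eqOn_span (f := (α : A →ₗ[ℂ] B)) (g := (β : A →ₗ[ℂ] B)) ?_
  rintro _ ⟨ξ, η, rfl⟩
  exact h ξ η

variable [T2Space A]

theorem IsFull.exists_algAut (hE : IsFull A E) (u : HilbertAut A E) :
    ∃ α : AlgAut A, ∀ ξ η : E, α.1 (inner A ξ η) = inner A (u.1 ξ) (u.1 η) := by
  obtain ⟨⟨α, hα, h⟩, β, hβ, k⟩ := u.2
  have left_inv : ∀ a, β (α a) = a :=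
    hE.hom_ext (α := β.comp α) (β := NonUnitalStarAlgHom.id ℂ A) (hβ.comp hα) continuous_id
      fun ξ η => by
        change β (α (inner A ξ η)) = inner A ξ η
        rw [← h, ← k, Equiv.symm_apply_apply, Equiv.symm_apply_apply]
  have right_inv : ∀ a, α (β a) = a :=
    hE.hom_ext (α := α.comp β) (β := NonUnitalStarAlgHom.id ℂ A) (hα.comp hβ) continuous_id
      fun ξ η => by
        change α (β (inner A ξ η)) = inner A ξ η
        rw [← k, ← h, Equiv.apply_symm_apply, Equiv.apply_symm_apply]
  exact ⟨⟨{ α with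
      invFun := β
      left_inv := left_inv
      right_inv := right_inv
      map_smul' := map_smul α }, hα, hβ⟩, fun ξ η => (h ξ η).symm⟩

theorem IsFull.algAut_ext (hE : IsFull A E) {α β : AlgAut A}
    (h : ∀ ξ η : E, α.1 (inner A ξ η) = β.1 (inner A ξ η)) : α = β :=
  Subtype.ext (StarAlgEquiv.ext (hE.hom_ext (α := (α.1 : A →⋆ₙₐ[ℂ] A)) (β := (β.1 : A →⋆ₙₐ[ℂ] A))
    α.2.1 β.2.1 h))

theorem IsFull.exists_algAction {G : Type*} [Group G] (hE : IsFull A E) (u : HilbertAction A E G) :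
    ∃ α : AlgAction G A, (∀ g ξ η, (α g).1 (inner A ξ η) = inner A ((u g).1 ξ) ((u g).1 η)) ∧
      ∀ α' : AlgAction G A,
        (∀ g ξ η, (α' g).1 (inner A ξ η) = inner A ((u g).1 ξ) ((u g).1 η)) → α' = α := by
  choose α hα using fun g => hE.exists_algAut (u g)
  refine ⟨MonoidHom.mk' α fun g k => hE.algAut_ext fun ξ η => ?_, hα, fun α' hα' =>
    MonoidHom.ext fun g => hE.algAut_ext fun ξ η => (hα' g ξ η).trans (hα g ξ η).symm⟩
  calc (α (g * k)).1 (inner A ξ η)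
      = inner A ((u (g * k)).1 ξ) ((u (g * k)).1 η) := hα _ ξ η
    _ = inner A ((u g).1 ((u k).1 ξ)) ((u g).1 ((u k).1 η)) := by rw [map_mul]; rfl
    _ = (α g * α k).1 (inner A ξ η) := by rw [← hα, ← hα]; rfl

end Covariant

section CovariantHilbert

open IsHilbertModule

variable {A B E F : Type*} [NonUnitalRing A] [StarRing A] [Module ℂ A] [UniformSpace A]
  [IsLocallyCStarAlgebra A] [NonUnitalRing B] [StarRing B] [Module ℂ B] [UniformSpace B]
  [IsLocallyCStarAlgebra B]
  [AddCommGroup E] [Module ℂ E] [SMul Aᵐᵒᵖ E] [Inner A E] [UniformSpace E] [IsHilbertModule A E]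
  [AddCommGroup F] [Module ℂ F] [SMul Bᵐᵒᵖ F] [Inner B F] [UniformSpace F] [IsHilbertModule B F]

theorem IsHilbertModule.eq_of_inner_eq {ξ η : E} (h₁ : inner A ξ ξ = inner A η ξ)
    (h₂ : inner A ξ η = inner A η η) : ξ = η := by
  rw [← sub_eq_zero, ← inner_self_eq_zero (A := A), ip_sub_left, ip_sub_right, ip_sub_right,
    h₁, h₂, sub_self]

namespace IsCovariant

variable {α : A →⋆ₙₐ[ℂ] B} {u : E → F} (h : IsCovariant α u)

include h

theorem map_add (ξ η : E) : u (ξ + η) = u ξ + u η := by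
  refine eq_of_inner_eq (A := B) ?_ ?_
  · simp only [ip_add_left, ip_add_right, h _ _, _root_.map_add]
    abel
  · simp only [ip_add_left, ip_add_right, h _ _, _root_.map_add]

theorem map_smul (c : ℂ) (ξ : E) : u (c • ξ) = c • u ξ := by
  apply eq_of_inner_eq (A := B) <;>
    simp only [ip_smul_left, ip_smul_right, h _ _, _root_.map_smul, smul_smul, mul_comm]

theorem map_rsmul (ξ : E) (a : A) : u (ξ <• a) = u ξ <• α a := by
  apply eq_of_inner_eq (A := B) <;>
    simp only [inner_rsmul_left, inner_rsmul_right, h _ _, map_mul, map_star, mul_assoc]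

/-- A covariant map, as a linear map. -/
def toLinearMap : E →ₗ[ℂ] F where
  toFun := u
  map_add' := h.map_add
  map_smul' := h.map_smul

theorem continuous (hα : Continuous α) : Continuous u :=
  continuous_of_seminorm_le (withSeminorms A E) (withSeminorms B F) h.toLinearMap.toAddMonoidHom
    fun p => ⟨p.pullback α hα, 1, fun ξ => by
      rw [one_mul]
      exact (h.modNorm_apply hα p ξ).le⟩

end IsCovariant

end CovariantHilbert

/-- The bijections of `E` that are covariant for the automorphism `α` of `A`. -/
structure CovariantPerm {A : Type*} [NonUnitalRing A] [StarRing A] [Module ℂ A]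
    [TopologicalSpace A] (α : AlgAut A) (E : Type*) [Inner A E] where
  perm : Equiv.Perm E
  inner_perm : ∀ ξ η, inner A (perm ξ) (perm η) = α.1 (inner A ξ η)

namespace CovariantPerm

open IsHilbertModule Adjointable

section Algebraic

variable {A E : Type*} [NonUnitalRing A] [StarRing A] [Module ℂ A] [TopologicalSpace A]
  [Inner A E] {α : AlgAut A}

/-- The inverse of a covariant bijection. -/
def symm (u : CovariantPerm α E) : CovariantPerm α⁻¹ E where
  perm := u.perm.symm
  inner_perm ξ η := by
    change _ = α.1.symm _
    rw [StarAlgEquiv.eq_symm_apply, ← u.inner_perm, Equiv.apply_symm_apply, Equiv.apply_symm_apply]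

variable (α) in
/-- The automorphism `α`, as a covariant bijection of `A`. -/
def self : CovariantPerm α A where
  perm := α.1.toEquiv
  inner_perm a b := by
    change star (α.1 a) * α.1 b = α.1 (star a * b)
    rw [map_mul, map_star]

theorem inner_perm_left (u : CovariantPerm α E) (ξ η : E) :
    inner A (u.perm ξ) η = α.1 (inner A ξ (u.perm.symm η)) := by
  rw [← u.inner_perm, Equiv.apply_symm_apply]

theorem inner_perm_right (u : CovariantPerm α E) (ξ η : E) :
    inner A ξ (u.perm η) = α.1 (inner A (u.perm.symm ξ) η) := by
  rw [← u.inner_perm, Equiv.apply_symm_apply]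

theorem modNorm_perm (u : CovariantPerm α E) (p : ContCStarSeminorm A) (ξ : E) :
    modNorm p.toCStarSeminorm (u.perm ξ) =
      modNorm (p.pullback (α.1 : A →⋆ₙₐ[ℂ] A) α.2.1).toCStarSeminorm ξ :=
  IsCovariant.modNorm_apply (α := (α.1 : A →⋆ₙₐ[ℂ] A)) u.inner_perm α.2.1 p ξ

end Algebraic

variable {A E F F' : Type*} [NonUnitalRing A] [StarRing A] [Module ℂ A] [UniformSpace A]
  [IsLocallyCStarAlgebra A]
  [AddCommGroup E] [Module ℂ E] [SMul Aᵐᵒᵖ E] [Inner A E] [UniformSpace E] [IsHilbertModule A E]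
  [AddCommGroup F] [Module ℂ F] [SMul Aᵐᵒᵖ F] [Inner A F] [UniformSpace F] [IsHilbertModule A F]
  [AddCommGroup F'] [Module ℂ F'] [SMul Aᵐᵒᵖ F'] [Inner A F'] [UniformSpace F']
  [IsHilbertModule A F'] {α : AlgAut A}

/-- A covariant bijection, as a linear map. -/
def toLinearMap (u : CovariantPerm α E) : E →ₗ[ℂ] E :=
  IsCovariant.toLinearMap (α := (α.1 : A →⋆ₙₐ[ℂ] A)) u.inner_perm

theorem map_rsmul (u : CovariantPerm α E) (ξ : E) (a : A) :
    u.perm (ξ <• a) = u.perm ξ <• α.1 a :=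
  IsCovariant.map_rsmul (α := (α.1 : A →⋆ₙₐ[ℂ] A)) u.inner_perm ξ a

theorem symm_rsmul (u : CovariantPerm α E) (ξ : E) (a : A) :
    u.perm.symm (ξ <• a) = u.perm.symm ξ <• α.1.symm a := u.symm.map_rsmul ξ a

/-- The operator `w T u⁻¹`. -/
def conj (w : CovariantPerm α F) (u : CovariantPerm α E) (T : Adjointable A E F) :
    Adjointable A E F :=
  ⟨w.toLinearMap ∘ₗ T.1 ∘ₗ u.symm.toLinearMap, fun ξ a => by
    change w.perm (T (u.perm.symm (ξ <• a))) = w.perm (T (u.perm.symm ξ)) <• a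
    rw [symm_rsmul, Adjointable.map_rsmul, map_rsmul, StarAlgEquiv.apply_symm_apply],
   u.toLinearMap ∘ₗ T.adj.1 ∘ₗ w.symm.toLinearMap, fun η a => by
    change u.perm (T.adj (w.perm.symm (η <• a))) = u.perm (T.adj (w.perm.symm η)) <• a
    rw [symm_rsmul, Adjointable.map_rsmul, map_rsmul, StarAlgEquiv.apply_symm_apply],
   fun ξ η => by
    change inner A (w.perm (T (u.perm.symm ξ))) η = inner A ξ (u.perm (T.adj (w.perm.symm η)))
    rw [inner_perm_left, inner_perm_right, inner_apply_left]⟩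

theorem conj_apply (w : CovariantPerm α F) (u : CovariantPerm α E) (T : Adjointable A E F)
    (ξ : E) : conj w u T ξ = w.perm (T (u.perm.symm ξ)) := rfl

theorem adj_conj (w : CovariantPerm α F) (u : CovariantPerm α E) (T : Adjointable A E F) :
    (conj w u T).adj = conj u w T.adj :=
  (eq_adj fun ξ η => by
    rw [conj_apply, conj_apply, inner_perm_left, inner_perm_right, inner_apply_left]).symm

theorem conj_comp (w' : CovariantPerm α F') (w : CovariantPerm α F) (u : CovariantPerm α E)
    (S : Adjointable A F F') (T : Adjointable A E F) :
    conj w' u (S.comp T) = (conj w' w S).comp (conj w u T) :=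
  Adjointable.ext fun ξ => by
    rw [comp_apply, conj_apply, conj_apply, conj_apply, comp_apply, Equiv.symm_apply_apply]

theorem conj_theta (w : CovariantPerm α F) (u : CovariantPerm α E) (η : F) (ξ : E) :
    conj w u (theta η ξ) = theta (w.perm η) (u.perm ξ) :=
  Adjointable.ext fun ζ => by
    rw [conj_apply, theta_apply, theta_apply, map_rsmul, inner_perm_left]

/-- Conjugation as a linear map. -/
def conjₗ (w : CovariantPerm α F) (u : CovariantPerm α E) :
    Adjointable A E F →ₗ[ℂ] Adjointable A E F where
  toFun := conj w u
  map_add' S T := Adjointable.ext fun ξ =>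
    w.toLinearMap.map_add (S (u.perm.symm ξ)) (T (u.perm.symm ξ))
  map_smul' c T := Adjointable.ext fun ξ => w.toLinearMap.map_smul c (T (u.perm.symm ξ))

theorem opNorm_conj_le (w : CovariantPerm α F) (u : CovariantPerm α E) (p : ContCStarSeminorm A)
    (T : Adjointable A E F) : opNorm p.toCStarSeminorm (conj w u T) ≤
      opNorm (p.pullback (α.1 : A →⋆ₙₐ[ℂ] A) α.2.1).toCStarSeminorm T :=
  iSup₂_le fun ξ hξ => by
    rw [conj_apply, modNorm_perm]
    refine ofReal_modNorm_le_opNorm T ?_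
    rwa [← modNorm_perm, Equiv.apply_symm_apply]

theorem continuous_conj (w : CovariantPerm α F) (u : CovariantPerm α E) :
    Continuous (conj w u) := by
  refine continuous_of_continuousAt_zero (conjₗ w u).toAddMonoidHom ?_
  rw [ContinuousAt, map_zero, Adjointable.tendsto_zero_iff]
  intro p
  exact tendsto_of_tendsto_of_tendsto_of_le_of_le tendsto_const_nhds
    (Adjointable.tendsto_zero_iff.1 tendsto_id (p.pullback (α.1 : A →⋆ₙₐ[ℂ] A) α.2.1))
    (fun _ => zero_le) (opNorm_conj_le w u p)

theorem conj_mem_compacts (w : CovariantPerm α F) (u : CovariantPerm α E) {T : Adjointable A E F}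
    (hT : T ∈ compacts A E F) : conj w u T ∈ compacts A E F := by
  refine map_mem_closure (continuous_conj w u) hT fun R hR => ?_
  have h : finiteRank A E F ≤ (finiteRank A E F).comap (conjₗ w u) := by
    refine Submodule.span_le.2 ?_
    rintro _ ⟨η, ξ, rfl⟩
    exact Submodule.subset_span ⟨_, _, conj_theta w u η ξ⟩
  exact h hR

/-- Conjugation on the compact operators. -/
def conjK (w : CovariantPerm α F) (u : CovariantPerm α E) (T : CompactOp A E F) :
    CompactOp A E F := ⟨conj w u T.1, conj_mem_compacts w u T.2⟩

theorem continuous_conjK (w : CovariantPerm α F) (u : CovariantPerm α E) :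
    Continuous (conjK w u) :=
  ((continuous_conj w u).comp continuous_subtype_val).subtype_mk _

theorem conjK_theta (w : CovariantPerm α F) (u : CovariantPerm α E) (η : F) (ξ : E) :
    conjK w u (CompactOp.theta η ξ) = CompactOp.theta (w.perm η) (u.perm ξ) :=
  Subtype.ext (conj_theta w u η ξ)

/-- Conjugation as a bijection of `K(E, F)`. -/
def conjPerm (w : CovariantPerm α F) (u : CovariantPerm α E) : Equiv.Perm (CompactOp A E F) where
  toFun := conjK w u
  invFun := conjK w.symm u.symm
  left_inv T := CompactOp.ext fun _ =>
    (Equiv.symm_apply_apply w.perm _).trans (congrArg T.1 (Equiv.symm_apply_apply u.perm _))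
  right_inv T := CompactOp.ext fun _ =>
    (Equiv.apply_symm_apply w.perm _).trans (congrArg T.1 (Equiv.apply_symm_apply u.perm _))

/-- Conjugation as a ⋆-homomorphism of `K(E)`. -/
def conjHom (u : CovariantPerm α E) : CompactOp A E E →⋆ₙₐ[ℂ] CompactOp A E E where
  toFun := conjK u u
  map_smul' c T := Subtype.ext ((conjₗ u u).map_smul c T.1)
  map_zero' := Subtype.ext (conjₗ u u).map_zero
  map_add' S T := Subtype.ext ((conjₗ u u).map_add S.1 T.1)
  map_mul' S T := Subtype.ext (conj_comp u u u S.1 T.1)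
  map_star' T := Subtype.ext (adj_conj u u T.1).symm

theorem inner_conjK (w : CovariantPerm α A) (u : CovariantPerm α E) (S T : CompactOp A E A) :
    inner (CompactOp A E E) (conjK w u S) (conjK w u T) =
      conjHom u (inner (CompactOp A E E) S T) :=
  Subtype.ext <| by
    change (conj w u S.1).adj.comp (conj w u T.1) = conj u u (S.1.adj.comp T.1)
    rw [adj_conj, conj_comp]

theorem conjPerm_mem_hilbertAut (w : CovariantPerm α A) (u : CovariantPerm α E) :
    conjPerm w u ∈ HilbertAut (CompactOp A E E) (CompactOp A E A) :=
  ⟨⟨conjHom u, continuous_conjK u u, inner_conjK w u⟩,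
    conjHom u.symm, continuous_conjK u.symm u.symm, inner_conjK w.symm u.symm⟩

theorem knorm_conjK_le (w : CovariantPerm α F) (u : CovariantPerm α E) (p : ContCStarSeminorm A)
    (T : CompactOp A E F) : CompactOp.knorm p (conjK w u T) ≤
      CompactOp.knorm (p.pullback (α.1 : A →⋆ₙₐ[ℂ] A) α.2.1) T :=
  ENNReal.toReal_mono (opNorm_ne_top _ T.2) (opNorm_conj_le w u p T.1)

theorem knorm_conjK_le_of_invariant (w : CovariantPerm α F) (u : CovariantPerm α E)
    {p : ContCStarSeminorm A} (hp : ∀ a, p.toCStarSeminorm (α.1 a) = p.toCStarSeminorm a)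
    (T : CompactOp A E F) : CompactOp.knorm p (conjK w u T) ≤ CompactOp.knorm p T :=
  (knorm_conjK_le w u p T).trans (CompactOp.knorm_mono (fun a => (hp a).le) T)

theorem knorm_conjK (w : CovariantPerm α F) (u : CovariantPerm α E) {p : ContCStarSeminorm A}
    (hp : ∀ a, p.toCStarSeminorm (α.1 a) = p.toCStarSeminorm a) (T : CompactOp A E F) :
    CompactOp.knorm p (conjK w u T) = CompactOp.knorm p T := by
  refine (knorm_conjK_le_of_invariant w u hp T).antisymm ?_
  have hp' (a : A) : p.toCStarSeminorm ((α⁻¹).1 a) = p.toCStarSeminorm a := by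
    rw [← hp ((α⁻¹).1 a)]
    exact congrArg p.toCStarSeminorm (α.1.apply_symm_apply a)
  calc CompactOp.knorm p T
      = CompactOp.knorm p (conjK w.symm u.symm (conjK w u T)) :=
        congrArg _ ((conjPerm w u).symm_apply_apply T).symm
    _ ≤ CompactOp.knorm p (conjK w u T) := knorm_conjK_le_of_invariant w.symm u.symm hp' _

end CovariantPerm

namespace CompactOp

variable {A E F : Type*} [NonUnitalRing A] [StarRing A] [Module ℂ A] [UniformSpace A]
  [IsLocallyCStarAlgebra A]
  [AddCommGroup E] [Module ℂ E] [SMul Aᵐᵒᵖ E] [Inner A E] [UniformSpace E] [IsHilbertModule A E]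
  [AddCommGroup F] [Module ℂ F] [SMul Aᵐᵒᵖ F] [Inner A F] [UniformSpace F] [IsHilbertModule A F]

theorem dense_span_theta :
    Dense (Submodule.span ℂ {T : CompactOp A E F | ∃ η ξ, T = theta η ξ} :
      Set (CompactOp A E F)) := by
  rw [Subtype.dense_iff]
  refine closure_mono ?_
  have h : finiteRank A E F ≤
      (Submodule.span ℂ {T : CompactOp A E F | ∃ η ξ, T = theta η ξ}).map
        (compacts A E F).subtype := by
    rw [Submodule.map_span, finiteRank]
    refine Submodule.span_mono ?_
    rintro _ ⟨η, ξ, rfl⟩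
    exact ⟨theta η ξ, ⟨η, ξ, rfl⟩, rfl⟩
  exact h

theorem hilbertAut_ext {v w : HilbertAut (CompactOp A E E) (CompactOp A E A)}
    (h : ∀ (a : A) (ξ : E), v.1 (theta a ξ) = w.1 (theta a ξ)) : v = w := by
  obtain ⟨α, hα, hv⟩ := v.2.1
  obtain ⟨β, hβ, hw⟩ := w.2.1
  replace hv : IsCovariant α v.1 := hv
  replace hw : IsCovariant β w.1 := hw
  refine Subtype.ext (Equiv.ext (congrFun ?_))
  have := IsHilbertModule.t2Space (CompactOp A E E) (CompactOp A E A)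
  refine Continuous.ext_on dense_span_theta (hv.continuous hα) (hw.continuous hβ) ?_
  refine LinearMap.eqOn_span (f := hv.toLinearMap) (g := hw.toLinearMap) ?_
  rintro _ ⟨a, ξ, rfl⟩
  exact h a ξ

variable {G : Type*} [Group G] (u : HilbertAction A E G) (α : AlgAction G A)
  (h : ∀ g ξ η, (α g).1 (inner A ξ η) = inner A ((u g).1 ξ) ((u g).1 η))

/-- The action of `G` on `K(E, A)` induced by an action on `E`. -/
def inducedAction : HilbertAction (CompactOp A E E) (CompactOp A E A) G :=
  MonoidHom.mk' (fun g => ⟨CovariantPerm.conjPerm (CovariantPerm.self (α g))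
      ⟨(u g).1, fun ξ η => (h g ξ η).symm⟩, CovariantPerm.conjPerm_mem_hilbertAut _ _⟩)
    fun g k => hilbertAut_ext fun a ξ => by
      change CovariantPerm.conjK _ _ _ = CovariantPerm.conjK _ _ (CovariantPerm.conjK _ _ _)
      rw [CovariantPerm.conjK_theta, CovariantPerm.conjK_theta, CovariantPerm.conjK_theta]
      change theta ((α (g * k)).1 a) ((u (g * k)).1 ξ) = _
      rw [map_mul, map_mul]
      rfl

/-- The ⋆-homomorphism of `K(E)` for which `inducedAction u α h g` is covariant. -/
def inducedHom (g : G) : CompactOp A E E →⋆ₙₐ[ℂ] CompactOp A E E :=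
  CovariantPerm.conjHom (α := α g) ⟨(u g).1, fun ξ η => (h g ξ η).symm⟩

theorem inducedAction_theta (g : G) (a : A) (ξ : E) :
    (inducedAction u α h g).1 (theta a ξ) = theta ((α g).1 a) ((u g).1 ξ) :=
  CovariantPerm.conjK_theta _ _ a ξ

theorem isCovariant_inducedAction (g : G) :
    IsCovariant (inducedHom u α h g) (inducedAction u α h g).1 :=
  CovariantPerm.inner_conjK _ _

end CompactOp

section ExtendOfNorm₂

variable {X Y X' Y' Z : Type*} [AddCommGroup X] [Module ℂ X] [AddCommGroup Y] [Module ℂ Y]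
  [SeminormedAddCommGroup X'] [NormedSpace ℂ X'] [NormedAddCommGroup Y'] [NormedSpace ℂ Y']
  [NormedAddCommGroup Z] [NormedSpace ℂ Z] [CompleteSpace Z]
  {σ : ℂ →+* ℂ} (f : X →ₛₗ[σ] Y →ₗ[ℂ] Z) {e : X →ₗ[ℂ] X'} {e' : Y →ₗ[ℂ] Y'}
  (he : DenseRange e) (he' : DenseRange e') (hf : ∀ x y, ‖f x y‖ ≤ ‖e x‖ * ‖e' y‖)

/-- The extension of a sesquilinear map in the second variable, along a map with dense range. -/
def extendRight : X →ₛₗ[σ] Y' →L[ℂ] Z where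
  toFun x := (f x).extendOfNorm e'
  map_add' x₁ x₂ := (f (x₁ + x₂)).extendOfNorm_unique he' _ (hf _) _ <| LinearMap.ext fun y => by
    simp [LinearMap.extendOfNorm_eq he' ⟨_, hf _⟩]
  map_smul' c x := (f (c • x)).extendOfNorm_unique he' _ (hf _) _ <| LinearMap.ext fun y => by
    simp [LinearMap.extendOfNorm_eq he' ⟨_, hf _⟩]

theorem norm_extendRight_le (x : X) : ‖extendRight f he' hf x‖ ≤ 1 * ‖e x‖ := by
  rw [one_mul]
  exact LinearMap.opNorm_extendOfNorm_le he' (norm_nonneg _) (hf x)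

/-- The extension of a bounded sesquilinear map along two maps with dense range. -/
def extendOfNorm₂ : X' →SL[σ] Y' →L[ℂ] Z :=
  (extendRight f he' hf).extendOfNorm e

include he in
theorem extendOfNorm₂_apply [RingHomIsometric σ] (x : X) (y : Y) :
    extendOfNorm₂ f he' hf (e x) (e' y) = f x y := by
  rw [extendOfNorm₂, LinearMap.extendOfNorm_eq he ⟨1, norm_extendRight_le f he' hf⟩]
  exact LinearMap.extendOfNorm_eq he' ⟨_, hf x⟩ y

end ExtendOfNorm₂

/-- The norm of a C⋆-algebra, as a continuous C⋆-seminorm. -/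
def normContCStarSeminorm (B : Type*) [NonUnitalCStarAlgebra B] : ContCStarSeminorm B where
  __ := normSeminorm ℂ B
  mul_le := norm_mul_le
  star_mul_self b := by
    change ‖star b * b‖ = ‖b‖ ^ 2
    rw [CStarRing.norm_star_mul_self, sq]
  continuous_toFun := continuous_norm

theorem isClosed_setOf_eq_star_mul_self (B : Type*) [NonUnitalCStarAlgebra B] :
    IsClosed {x : B | ∃ b, x = star b * b} := by
  let _ := CStarAlgebra.spectralOrder B
  have := CStarAlgebra.spectralOrderedRing B
  simp only [← CStarAlgebra.nonneg_iff_eq_star_mul_self]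
  exact CStarAlgebra.isClosed_nonneg

open IsHilbertModule

section ModCompl

variable {A E : Type*} [NonUnitalRing A] [StarRing A] [Module ℂ A] [UniformSpace A]
  [IsLocallyCStarAlgebra A]
  [AddCommGroup E] [Module ℂ E] [SMul Aᵐᵒᵖ E] [Inner A E] [UniformSpace E] [IsHilbertModule A E]

/-- The module `E`, equipped with the seminorm `modNorm p`. -/
def WithModSeminorm (_ : CStarSeminorm A) (E : Type*) : Type _ := E

instance (p : CStarSeminorm A) : AddCommGroup (WithModSeminorm p E) :=
  inferInstanceAs (AddCommGroup E)

instance (p : CStarSeminorm A) : Module ℂ (WithModSeminorm p E) := inferInstanceAs (Module ℂ E)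

instance (p : CStarSeminorm A) : SeminormedAddCommGroup (WithModSeminorm p E) :=
  AddGroupSeminorm.toSeminormedAddCommGroup (E := WithModSeminorm p E)
    (modSeminorm E p).toAddGroupSeminorm

instance (p : CStarSeminorm A) : NormedSpace ℂ (WithModSeminorm p E) where
  norm_smul_le c ξ := (modNorm_smul (E := E) p c ξ).le

/-- The Hausdorff completion of `E` with respect to `modNorm p`. -/
abbrev ModCompl (p : CStarSeminorm A) (E : Type*) [AddCommGroup E] [Module ℂ E] [SMul Aᵐᵒᵖ E]
    [Inner A E] [UniformSpace E] [IsHilbertModule A E] : Type _ :=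
  Completion (WithModSeminorm p E)

variable (E) in
/-- The canonical map of `E` into its completion with respect to `modNorm p`. -/
def toModCompl (p : CStarSeminorm A) : E →ₗ[ℂ] ModCompl p E where
  toFun ξ := ((show WithModSeminorm p E from ξ : WithModSeminorm p E) : ModCompl p E)
  map_add' ξ η := Completion.coe_add (show WithModSeminorm p E from ξ) η
  map_smul' c ξ := Completion.coe_smul c (show WithModSeminorm p E from ξ)

theorem norm_toModCompl (p : CStarSeminorm A) (ξ : E) : ‖toModCompl E p ξ‖ = modNorm p ξ :=
  Completion.norm_coe (show WithModSeminorm p E from ξ)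

theorem denseRange_toModCompl (p : CStarSeminorm A) : DenseRange (toModCompl E p) :=
  Completion.denseRange_coe (α := WithModSeminorm p E)

namespace ModCompl

variable (p : CStarSeminorm A)

variable (E) in
/-- The right action of `A` on `E`, with values in the completion. -/
def rsmulₗ : E →ₗ[ℂ] A →ₗ[ℂ] ModCompl p E :=
  LinearMap.mk₂ ℂ (fun ξ a => toModCompl E p (ξ <• a))
    (fun ξ η a => by rw [add_rsmul, map_add]) (fun c ξ a => by rw [smul_rsmul, map_smul])
    (fun ξ a b => by rw [rsmul_add, map_add]) fun c ξ a => by rw [rsmul_smul, map_smul]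

variable (E) in
/-- The inner product of `E`, with values in the completion of `A`. -/
def innerₗ : E →ₗ⋆[ℂ] E →ₗ[ℂ] p.Compl :=
  LinearMap.mk₂'ₛₗ (starRingEnd ℂ) (.id ℂ) (fun ξ η => p.toComplHom (inner A ξ η))
    (fun ξ η ζ => by rw [ip_add_left, map_add])
    (fun c ξ η => by rw [ip_smul_left, map_smul, starRingEnd_apply])
    (fun ξ η ζ => by rw [ip_add_right, map_add])
    fun c ξ η => by rw [ip_smul_right, map_smul, RingHom.id_apply]

theorem norm_rsmulₗ_le (ξ : E) (a : A) :
    ‖rsmulₗ E p ξ a‖ ≤ ‖toModCompl E p ξ‖ * ‖(p.toComplHom : A →ₗ[ℂ] p.Compl) a‖ := by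
  change ‖toModCompl E p (ξ <• a)‖ ≤ ‖toModCompl E p ξ‖ * ‖p.toComplHom a‖
  rw [norm_toModCompl, norm_toModCompl, p.norm_toComplHom]
  exact modNorm_rsmul_le p ξ a

theorem norm_innerₗ_le (ξ η : E) :
    ‖innerₗ E p ξ η‖ ≤ ‖toModCompl E p ξ‖ * ‖toModCompl E p η‖ := by
  change ‖p.toComplHom (inner A ξ η)‖ ≤ _
  rw [norm_toModCompl, norm_toModCompl, p.norm_toComplHom]
  exact cauchy_schwarz p ξ η

variable (E) in
/-- The right action of the completion of `A` on the completion of `E`, as a bounded bilinear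
map. -/
def rsmulL : ModCompl p E →L[ℂ] p.Compl →L[ℂ] ModCompl p E :=
  extendOfNorm₂ (rsmulₗ E p) p.denseRange_toComplHom (norm_rsmulₗ_le p)

variable (E) in
/-- The inner product of the completion of `E`, as a bounded sesquilinear map. -/
def innerL : ModCompl p E →L⋆[ℂ] ModCompl p E →L[ℂ] p.Compl :=
  extendOfNorm₂ (innerₗ E p) (denseRange_toModCompl p) (norm_innerₗ_le p)

instance : SMul p.Complᵐᵒᵖ (ModCompl p E) := ⟨fun a x => rsmulL E p x a.unop⟩

instance : Inner p.Compl (ModCompl p E) := ⟨fun x y => innerL E p x y⟩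

variable {p}

theorem rsmul_coe (ξ : E) (a : A) :
    toModCompl E p ξ <• p.toComplHom a = toModCompl E p (ξ <• a) :=
  extendOfNorm₂_apply (rsmulₗ E p) (denseRange_toModCompl p) p.denseRange_toComplHom
    (norm_rsmulₗ_le p) ξ a

theorem inner_coe (ξ η : E) :
    inner p.Compl (toModCompl E p ξ) (toModCompl E p η) = p.toComplHom (inner A ξ η) :=
  extendOfNorm₂_apply (innerₗ E p) (denseRange_toModCompl p) (denseRange_toModCompl p)
    (norm_innerₗ_le p) ξ η

@[fun_prop]
theorem continuous_rsmul {Z : Type*} [TopologicalSpace Z] {f : Z → ModCompl p E}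
    {g : Z → p.Compl} (hf : Continuous f) (hg : Continuous g) :
    Continuous fun z => f z <• g z :=
  ((rsmulL E p).continuous.comp hf).clm_apply hg

@[fun_prop]
theorem continuous_inner {Z : Type*} [TopologicalSpace Z] {f g : Z → ModCompl p E}
    (hf : Continuous f) (hg : Continuous g) :
    Continuous fun z => inner p.Compl (f z) (g z) :=
  ((innerL E p).continuous.comp hf).clm_apply hg

theorem norm_inner_self (x : ModCompl p E) : ‖inner p.Compl x x‖ = ‖x‖ ^ 2 :=
  (denseRange_toModCompl p).induction_on (p := fun x => ‖inner p.Compl x x‖ = ‖x‖ ^ 2) x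
    (isClosed_eq (by fun_prop) (by fun_prop)) fun ξ => by
      rw [inner_coe, p.norm_toComplHom, norm_toModCompl, modNorm_sq]

theorem modNorm_normContCStarSeminorm (x : ModCompl p E) :
    modNorm (normContCStarSeminorm p.Compl).toCStarSeminorm x = ‖x‖ := by
  change √‖inner p.Compl x x‖ = _
  rw [norm_inner_self, Real.sqrt_sq (norm_nonneg x)]

theorem continuous_modNorm (r : ContCStarSeminorm p.Compl) :
    Continuous (modNorm r.toCStarSeminorm : ModCompl p E → ℝ) :=
  (r.continuous_toFun.comp (continuous_inner continuous_id continuous_id)).sqrt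

theorem inner_rsmul_right (x y : ModCompl p E) (a : p.Compl) :
    inner p.Compl x (y <• a) = inner p.Compl x y * a := by
  induction a using p.denseRange_toComplHom.induction_on
  · exact isClosed_eq (by fun_prop) (by fun_prop)
  induction x, y using (denseRange_toModCompl p).induction_on₂
  · exact isClosed_eq (by fun_prop) (by fun_prop)
  rw [rsmul_coe, inner_coe, inner_coe, IsHilbertModule.inner_rsmul_right, map_mul]

theorem rsmul_mul (x : ModCompl p E) (a b : p.Compl) : x <• (a * b) = (x <• a) <• b := by
  induction x using (denseRange_toModCompl p).induction_on
  · exact isClosed_eq (by fun_prop) (by fun_prop)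
  induction a, b using p.denseRange_toComplHom.induction_on₂
  · exact isClosed_eq (by fun_prop) (by fun_prop)
  rw [← map_mul, rsmul_coe, rsmul_coe, rsmul_coe, IsHilbertModule.rsmul_mul]

theorem star_inner (x y : ModCompl p E) : star (inner p.Compl x y) = inner p.Compl y x := by
  induction x, y using (denseRange_toModCompl p).induction_on₂
  · exact isClosed_eq (by fun_prop) (by fun_prop)
  rw [inner_coe, inner_coe, ← map_star, IsHilbertModule.star_inner]

theorem inner_self_pos (x : ModCompl p E) : ∃ b : p.Compl, inner p.Compl x x = star b * b := by
  induction x using (denseRange_toModCompl p).induction_on with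
  | hp =>
    exact (isClosed_setOf_eq_star_mul_self p.Compl).preimage
      (continuous_inner continuous_id continuous_id)
  | ih ξ =>
    obtain ⟨b, hb⟩ := IsHilbertModule.inner_self_pos (A := A) ξ
    exact ⟨p.toComplHom b, by rw [inner_coe, hb, map_mul, map_star]⟩

theorem nhds_zero : 𝓝 (0 : ModCompl p E) =
    ⨅ r : ContCStarSeminorm p.Compl, Filter.comap (modNorm r.toCStarSeminorm) (𝓝 0) := by
  refine le_antisymm (le_iInf fun r => ?_) (iInf_le_of_le (normContCStarSeminorm p.Compl) ?_)
  · have h : modNorm r.toCStarSeminorm (0 : ModCompl p E) = 0 := by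
      rw [modNorm, show inner p.Compl (0 : ModCompl p E) 0 = 0 from map_zero (innerL E p 0),
        map_zero, Real.sqrt_zero]
    exact tendsto_iff_comap.1 (h ▸ (continuous_modNorm r).tendsto 0)
  · rw [funext modNorm_normContCStarSeminorm, comap_norm_nhds_zero]

instance : IsHilbertModule p.Compl (ModCompl p E) where
  isUniformAddGroup := inferInstance
  completeSpace := inferInstance
  add_rsmul x y a := (rsmulL E p).map_add₂ x y a
  rsmul_add x := map_add (rsmulL E p x)
  rsmul_mul := rsmul_mul
  smul_rsmul c x a := (rsmulL E p).map_smul₂ c x a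
  rsmul_smul c x := map_smul (rsmulL E p x) c
  ip_add_right x := map_add (innerL E p x)
  ip_smul_right c x := map_smul (innerL E p x) c
  inner_rsmul_right := inner_rsmul_right
  star_inner := star_inner
  inner_self_pos := inner_self_pos
  inner_self_eq_zero x := by rw [← norm_eq_zero, norm_inner_self, sq_eq_zero_iff, norm_eq_zero]
  nhds_zero := nhds_zero

end ModCompl

end ModCompl

namespace ModCompl

variable {A B E F : Type*} [NonUnitalRing A] [StarRing A] [Module ℂ A] [UniformSpace A]
  [IsLocallyCStarAlgebra A] [NonUnitalRing B] [StarRing B] [Module ℂ B] [UniformSpace B]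
  [IsLocallyCStarAlgebra B]
  [AddCommGroup E] [Module ℂ E] [SMul Aᵐᵒᵖ E] [Inner A E] [UniformSpace E] [IsHilbertModule A E]
  [AddCommGroup F] [Module ℂ F] [SMul Bᵐᵒᵖ F] [Inner B F] [UniformSpace F] [IsHilbertModule B F]
  {p : CStarSeminorm A} {q : CStarSeminorm B} (f : E →ₗ[ℂ] F)

variable (p q) in
/-- The extension of a contractive linear map to the completions; zero if `f` is not bounded. -/
def map : ModCompl p E →L[ℂ] ModCompl q F := (toModCompl F q ∘ₗ f).extendOfNorm (toModCompl E p)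

variable {f} (hf : ∀ ξ, modNorm q (f ξ) ≤ modNorm p ξ)

include hf in
theorem map_coe (ξ : E) : map p q f (toModCompl E p ξ) = toModCompl F q (f ξ) :=
  LinearMap.extendOfNorm_eq (denseRange_toModCompl p) ⟨1, fun η => by
    rw [LinearMap.comp_apply, norm_toModCompl, norm_toModCompl, one_mul]
    exact hf η⟩ ξ

theorem isCovariant_map {α : A →⋆ₙₐ[ℂ] B} (hα : ∀ a, q (α a) ≤ p a) (h : IsCovariant α f) :
    IsCovariant (CStarSeminorm.complMap hα) (map p q f) := by
  have := CStarSeminorm.continuous_complMap hα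
  intro x y
  induction x, y using (denseRange_toModCompl p).induction_on₂
  · exact isClosed_eq (by fun_prop) (by fun_prop)
  rw [map_coe (h.modNorm_apply_le hα), map_coe (h.modNorm_apply_le hα), inner_coe, inner_coe,
    CStarSeminorm.complMap_coe, h]

end ModCompl

section Directed

section Seminorms

variable {X Λ : Type*} [AddCommGroup X] [Module ℂ X] [TopologicalSpace X]

theorem exists_le_mul_of_monotone [Preorder Λ] [IsDirectedOrder Λ] [Nonempty Λ]
    {r : SeminormFamily ℂ X Λ} (hr : Monotone r) (hgen : WithSeminorms r) {p : Seminorm ℂ X}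
    (hp : Continuous p) : ∃ i, ∃ C : ℝ, 0 ≤ C ∧ ∀ x, p x ≤ C * r i x := by
  obtain ⟨s, C, -, hsC⟩ := Seminorm.bound_of_continuous hgen p hp
  obtain ⟨i, hi⟩ := s.exists_le
  have hsup : s.sup r ≤ r i := Finset.sup_le fun j hj => hr (hi j hj)
  exact ⟨i, C, C.2, fun x => (hsC x).trans (mul_le_mul_of_nonneg_left (hsup x) C.2)⟩

theorem withSeminorms_of_forall_exists_le_mul {Λ' : Type*} {p : SeminormFamily ℂ X Λ}
    {q : SeminormFamily ℂ X Λ'} (hp : WithSeminorms p) (hq : ∀ j, Continuous (q j))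
    (h : ∀ i, ∃ j, ∃ C : ℝ, ∀ x, p i x ≤ C * q j x) : WithSeminorms q := by
  have := hp.topologicalAddGroup
  refine q.withSeminorms_iff_nhds_eq_iInf.2 (le_antisymm (le_iInf fun j => ?_) ?_)
  · rw [← tendsto_iff_comap, ← map_zero (q j)]
    exact (hq j).tendsto 0
  · rw [p.withSeminorms_iff_nhds_eq_iInf.1 hp]
    refine le_iInf fun i => ?_
    obtain ⟨j, C, hC⟩ := h i
    refine (iInf_le _ j).trans (tendsto_iff_comap.1 (squeeze_zero (apply_nonneg _) hC ?_))
    simpa using (tendsto_comap (f := q j) (x := 𝓝 0)).const_mul C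

end Seminorms

theorem exists_modNorm_le_mul {A Λ : Type*} [NonUnitalRing A] [StarRing A] [Module ℂ A]
    [TopologicalSpace A] [Preorder Λ] [IsDirectedOrder Λ] [Nonempty Λ] {r : Λ → ContCStarSeminorm A}
    (E : Type*) [Inner A E] (hr : Monotone r) (hgen : WithSeminorms fun i => (r i).toSeminorm)
    (p : ContCStarSeminorm A) : ∃ i, ∃ C : ℝ, ∀ ξ : E,
      modNorm p.toCStarSeminorm ξ ≤ C * modNorm (r i).toCStarSeminorm ξ := by
  obtain ⟨i, C, hC, h⟩ := exists_le_mul_of_monotone hr hgen (p := p.toSeminorm) p.continuous_toFun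
  refine ⟨i, √C, fun ξ => ?_⟩
  rw [modNorm, modNorm, ← Real.sqrt_mul hC]
  exact Real.sqrt_le_sqrt (h _)

variable {A E F Λ : Type*} [NonUnitalRing A] [StarRing A] [Module ℂ A] [UniformSpace A]
  [IsLocallyCStarAlgebra A]
  [AddCommGroup E] [Module ℂ E] [SMul Aᵐᵒᵖ E] [Inner A E] [UniformSpace E] [IsHilbertModule A E]
  [AddCommGroup F] [Module ℂ F] [SMul Aᵐᵒᵖ F] [Inner A F] [UniformSpace F] [IsHilbertModule A F]
  [Preorder Λ] [IsDirectedOrder Λ] [Nonempty Λ] {r : Λ → ContCStarSeminorm A}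

theorem IsHilbertModule.withSeminorms_of_monotone (hr : Monotone r)
    (hgen : WithSeminorms fun i => (r i).toSeminorm) :
    WithSeminorms fun i => modSeminorm E (r i).toCStarSeminorm :=
  withSeminorms_of_forall_exists_le_mul (withSeminorms A E) (fun i => continuous_modNorm (r i))
    (exists_modNorm_le_mul E hr hgen)

theorem CompactOp.withSeminorms_of_monotone (hr : Monotone r)
    (hgen : WithSeminorms fun i => (r i).toSeminorm) :
    WithSeminorms fun i => kSeminorm E F (r i) :=
  withSeminorms_of_forall_exists_le_mul (withSeminorms A E F)
    (fun i => (withSeminorms A E F).continuous_seminorm (r i)) fun p => by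
      obtain ⟨i, C, h⟩ := exists_modNorm_le_mul E hr hgen p
      exact ⟨i, 1, fun T => (knorm_le_knorm h T).trans_eq (one_mul _).symm⟩

end Directed

section InvariantSeminorm

variable {A G : Type*} [NonUnitalRing A] [StarRing A] [Module ℂ A] [TopologicalSpace A]

/-- The continuous C⋆-seminorms that are invariant under a family of endomorphisms. -/
abbrev InvariantSeminorm (β : G → A →⋆ₙₐ[ℂ] A) : Type _ :=
  {q : ContCStarSeminorm A // ∀ g a, q.toCStarSeminorm (β g a) = q.toCStarSeminorm a}

variable (β : G → A →⋆ₙₐ[ℂ] A)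

instance : Nonempty (InvariantSeminorm β) :=
  ⟨{ (0 : Seminorm ℂ A) with
     mul_le := fun _ _ => (mul_zero (0 : ℝ)).ge
     star_mul_self := fun _ => (zero_pow two_ne_zero : (0 : ℝ) ^ 2 = 0).symm
     continuous_toFun := continuous_const }, fun _ _ => rfl⟩

instance : IsDirectedOrder (InvariantSeminorm β) :=
  ⟨fun p q => ⟨⟨p.1 ⊔ q.1, fun g a => by
      rw [ContCStarSeminorm.max_apply, ContCStarSeminorm.max_apply, p.2, q.2]⟩,
    fun _ => le_max_left _ _, fun _ => le_max_right _ _⟩⟩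

end InvariantSeminorm

section InverseLimit

open IsHilbertModule

variable {A E G : Type*} [NonUnitalRing A] [StarRing A] [Module ℂ A] [UniformSpace A]
  [IsLocallyCStarAlgebra A]
  [AddCommGroup E] [Module ℂ E] [SMul Aᵐᵒᵖ E] [Inner A E] [UniformSpace E] [IsHilbertModule A E]

section System

open CStarSeminorm

variable {p q : CStarSeminorm A} (h : ∀ a, q a ≤ p a)

include h

theorem ModCompl.isCovariant_map_id :
    IsCovariant (complOfLE h) (ModCompl.map p q (.id : E →ₗ[ℂ] E)) :=
  isCovariant_map (α := .id ℂ A) h fun _ _ => rfl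

theorem ModCompl.map_id_coe (ξ : E) :
    ModCompl.map p q .id (toModCompl E p ξ) = toModCompl E q ξ :=
  map_coe (fun _ => Real.sqrt_le_sqrt (h _)) ξ

theorem ModCompl.map_id_rsmul (x : ModCompl p E) (a : p.Compl) :
    ModCompl.map p q (.id : E →ₗ[ℂ] E) (x <• a) =
      ModCompl.map p q (.id : E →ₗ[ℂ] E) x <• complOfLE h a := by
  have := continuous_complOfLE h
  induction x using (denseRange_toModCompl p).induction_on
  · exact isClosed_eq (by fun_prop) (by fun_prop)
  induction a using p.denseRange_toComplHom.induction_on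
  · exact isClosed_eq (by fun_prop) (by fun_prop)
  rw [rsmul_coe, map_id_coe h, map_id_coe h, complOfLE_coe, rsmul_coe]

end System

variable (E) in
/-- The inverse system of the completions of `E` with respect to the invariant seminorms. -/
def invariantSystem (β : G → A →⋆ₙₐ[ℂ] A) : HilbertSystem (InvariantSeminorm β) where
  alg q := q.1.Compl
  mod q := ModCompl q.1.toCStarSeminorm E
  algMap h := CStarSeminorm.complOfLE h
  modMap {p q} _ := (ModCompl.map q.1.toCStarSeminorm p.1.toCStarSeminorm .id).toLinearMap
  algMap_refl q a := by
    have := CStarSeminorm.continuous_complOfLE (le_refl q)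
    induction a using q.1.denseRange_toComplHom.induction_on
    · exact isClosed_eq (by fun_prop) (by fun_prop)
    rw [CStarSeminorm.complOfLE_coe]
  algMap_comp {p q r} hpq hqr a := by
    have := CStarSeminorm.continuous_complOfLE hpq
    have := CStarSeminorm.continuous_complOfLE hqr
    have := CStarSeminorm.continuous_complOfLE (hpq.trans hqr)
    induction a using r.1.denseRange_toComplHom.induction_on
    · exact isClosed_eq (by fun_prop) (by fun_prop)
    rw [CStarSeminorm.complOfLE_coe, CStarSeminorm.complOfLE_coe, CStarSeminorm.complOfLE_coe]
  modMap_refl q ξ := by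
    induction ξ using (denseRange_toModCompl q.1.toCStarSeminorm).induction_on
    · exact isClosed_eq (by fun_prop) (by fun_prop)
    exact ModCompl.map_id_coe (fun _ => le_rfl) _
  modMap_comp {p q r} hpq hqr ξ := by
    induction ξ using (denseRange_toModCompl r.1.toCStarSeminorm).induction_on
    · exact isClosed_eq (by fun_prop) (by fun_prop)
    simp only [ContinuousLinearMap.coe_coe]
    rw [ModCompl.map_id_coe hqr, ModCompl.map_id_coe hpq, ModCompl.map_id_coe (hpq.trans hqr)]
  modMap_rsmul h := ModCompl.map_id_rsmul h
  inner_modMap h := ModCompl.isCovariant_map_id h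

variable (E) in
theorem isUniformInducing_toModCompl {Λ : Type*} {r : Λ → ContCStarSeminorm A}
    (hgen : WithSeminorms fun i => modSeminorm E (r i).toCStarSeminorm) :
    IsUniformInducing fun (ξ : E) i => toModCompl E (r i).toCStarSeminorm ξ :=
  have := isUniformAddGroup (A := A) (E := E)
  isUniformInducing_pi_of_withSeminorms hgen
    (fun i => (toModCompl E (r i).toCStarSeminorm).toAddMonoidHom) fun _ => norm_toModCompl _

variable {β : G → A →⋆ₙₐ[ℂ] A} (hgen : WithSeminorms fun q : InvariantSeminorm β => q.1.toSeminorm)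

variable (E) in
/-- If the invariant seminorms generate the topology of `A`, then `E` is the inverse limit of its
completions with respect to them. -/
def invariantLimit : (invariantSystem E β).Limit A E where
  π q := q.1.toComplHom
  σ q := toModCompl E q.1.toCStarSeminorm
  algMap_π h := CStarSeminorm.complOfLE_coe h
  modMap_σ h := ModCompl.map_id_coe h
  σ_rsmul _ ξ a := (ModCompl.rsmul_coe ξ a).symm
  inner_σ _ := ModCompl.inner_coe
  existsUnique_alg := IsLocallyCStarAlgebra.existsUnique_toComplHom_eq hgen fun h => h
  existsUnique_mod _ hx :=
    have := completeSpace (A := A) (E := E)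
    have := t2Space A E
    existsUnique_of_coherent (Y := fun q : InvariantSeminorm β => ModCompl q.1.toCStarSeminorm E)
      (isUniformInducing_toModCompl E (withSeminorms_of_monotone (Subtype.mono_coe _) hgen))
      (fun _ => denseRange_toModCompl _)
      (fun _ => (ModCompl.map _ _ .id).continuous)
      (fun h => ModCompl.map_id_coe h) hx
  isInducing_alg := (IsLocallyCStarAlgebra.isUniformInducing_toComplHom hgen).isInducing
  isInducing_mod := (isUniformInducing_toModCompl E
    (withSeminorms_of_monotone (Subtype.mono_coe _) hgen)).isInducing

variable [Group G] {v : HilbertAction A E G} (hβ : ∀ g, IsCovariant (β g) (v g).1)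

/-- The map induced by `v g` on the completion with respect to an invariant seminorm. -/
def invariantMap (q : InvariantSeminorm β) (g : G) :
    ModCompl q.1.toCStarSeminorm E →L[ℂ] ModCompl q.1.toCStarSeminorm E :=
  ModCompl.map _ _ (hβ g).toLinearMap

theorem invariantMap_coe (q : InvariantSeminorm β) (g : G) (ξ : E) :
    invariantMap hβ q g (toModCompl E q.1.toCStarSeminorm ξ) =
      toModCompl E q.1.toCStarSeminorm ((v g).1 ξ) :=
  ModCompl.map_coe (f := (hβ g).toLinearMap)
    ((hβ g).modNorm_apply_le fun a => (q.2 g a).le) ξ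

theorem isHilbertMorphism_invariantMap (q : InvariantSeminorm β) (g : G) :
    IsHilbertMorphism q.1.Compl q.1.Compl (invariantMap hβ q g) :=
  ⟨CStarSeminorm.complMap fun a => (q.2 g a).le, CStarSeminorm.continuous_complMap _,
    ModCompl.isCovariant_map (f := (hβ g).toLinearMap) _ (hβ g)⟩

theorem invariantMap_mul (q : InvariantSeminorm β) (g k : G)
    (x : ModCompl q.1.toCStarSeminorm E) :
    invariantMap hβ q (g * k) x = invariantMap hβ q g (invariantMap hβ q k x) := by
  induction x using (denseRange_toModCompl q.1.toCStarSeminorm).induction_on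
  · exact isClosed_eq (by fun_prop) (by fun_prop)
  rw [invariantMap_coe, invariantMap_coe, invariantMap_coe, map_mul]
  rfl

theorem invariantMap_one (q : InvariantSeminorm β) (x : ModCompl q.1.toCStarSeminorm E) :
    invariantMap hβ q 1 x = x := by
  induction x using (denseRange_toModCompl q.1.toCStarSeminorm).induction_on
  · exact isClosed_eq (by fun_prop) (by fun_prop)
  rw [invariantMap_coe, map_one]
  rfl

/-- The action on the completion with respect to an invariant seminorm. -/
def invariantAction (q : InvariantSeminorm β) :
    HilbertAction q.1.Compl (ModCompl q.1.toCStarSeminorm E) G :=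
  MonoidHom.mk' (fun g => ⟨
    { toFun := invariantMap hβ q g
      invFun := invariantMap hβ q g⁻¹
      left_inv := fun x => by rw [← invariantMap_mul, inv_mul_cancel, invariantMap_one]
      right_inv := fun x => by rw [← invariantMap_mul, mul_inv_cancel, invariantMap_one] },
    isHilbertMorphism_invariantMap hβ q g, isHilbertMorphism_invariantMap hβ q g⁻¹⟩)
    fun g k => Subtype.ext (Equiv.ext fun x => invariantMap_mul hβ q g k x)

theorem map_id_invariantMap {p q : InvariantSeminorm β} (h : p ≤ q) (g : G)
    (x : ModCompl q.1.toCStarSeminorm E) :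
    ModCompl.map q.1.toCStarSeminorm p.1.toCStarSeminorm .id (invariantMap hβ q g x) =
      invariantMap hβ p g (ModCompl.map q.1.toCStarSeminorm p.1.toCStarSeminorm .id x) := by
  induction x using (denseRange_toModCompl q.1.toCStarSeminorm).induction_on
  · exact isClosed_eq (by fun_prop) (by fun_prop)
  rw [invariantMap_coe, ModCompl.map_id_coe h, ModCompl.map_id_coe h, invariantMap_coe]

include hgen hβ in
theorem isInverseLimitAction_of_withSeminorms_invariant : IsInverseLimitAction v :=
  ⟨InvariantSeminorm β, inferInstance, inferInstance, inferInstance, invariantSystem E β,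
    invariantLimit E hgen, invariantAction hβ, map_id_invariantMap hβ,
    fun q g ξ => (invariantMap_coe hβ q g ξ).symm⟩

end InverseLimit

namespace Adjointable

open IsHilbertModule

variable {A E : Type*} [NonUnitalRing A] [StarRing A] [Module ℂ A] [UniformSpace A]
  [IsLocallyCStarAlgebra A]
  [AddCommGroup E] [Module ℂ E] [SMul Aᵐᵒᵖ E] [Inner A E] [UniformSpace E] [IsHilbertModule A E]

/-- The operator `ξ ↦ ⟨ζ, ξ⟩` from `E` to `A`. -/
def innerLeft (ζ : E) : Adjointable A E A :=
  ⟨{ toFun := fun ξ => inner A ζ ξ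
     map_add' := ip_add_right ζ
     map_smul' := fun c ξ => ip_smul_right c ζ ξ },
   inner_rsmul_right ζ,
   { toFun := fun a => ζ <• a
     map_add' := rsmul_add ζ
     map_smul' := fun c a => rsmul_smul c ζ a },
   rsmul_mul ζ,
   fun ξ a => by
    change star (inner A ζ ξ) * a = inner A ξ (ζ <• a)
    rw [inner_rsmul_right, star_inner]⟩

theorem theta_eq_innerLeft (a : A) (ξ : E) :
    (theta a ξ : Adjointable A E A) = innerLeft (ξ <• star a) :=
  ext fun ζ => by
    change a * inner A ξ ζ = inner A (ξ <• star a) ζ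
    rw [inner_rsmul_left, star_star]

theorem opNorm_innerLeft_le (p : CStarSeminorm A) (ζ : E) :
    opNorm p (innerLeft ζ) ≤ ENNReal.ofReal (modNorm p ζ) :=
  opNorm_le (modNorm_nonneg _ _) fun ξ => (modNorm_self p _).trans_le (cauchy_schwarz p ζ ξ)

theorem continuous_innerLeft : Continuous (innerLeft : E → Adjointable A E A) := by
  have := isUniformAddGroup (A := A) (E := E)
  refine continuous_of_continuousAt_zero
    (AddMonoidHom.mk' innerLeft fun ζ ζ' => ext fun ξ => ip_add_left ζ ζ' ξ) ?_
  rw [ContinuousAt, map_zero, tendsto_zero_iff]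
  intro p
  have hp := ENNReal.tendsto_ofReal
    ((IsHilbertModule.tendsto_zero_iff (A := A) (E := E)).1 tendsto_id p)
  rw [ENNReal.ofReal_zero] at hp
  exact tendsto_of_tendsto_of_tendsto_of_le_of_le tendsto_const_nhds hp (fun _ => zero_le)
    (opNorm_innerLeft_le p.toCStarSeminorm)

end Adjointable

section InvariantGenerators

variable {A E G : Type*} [NonUnitalRing A] [StarRing A] [Module ℂ A] [TopologicalSpace A]
  [Group G]

theorem AlgAction.apply_inv_apply_self (α : AlgAction G A) (g : G) (a : A) :
    (α g⁻¹).1 ((α g).1 a) = a := by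
  change (α g⁻¹ * α g).1 a = a
  rw [← map_mul, inv_mul_cancel, map_one]
  rfl

variable [AddCommGroup E] [Module ℂ E] [SMul Aᵐᵒᵖ E] [Inner A E] [TopologicalSpace E]

namespace HilbertSystem.Limit

variable {Λ : Type*} [Preorder Λ] {D : HilbertSystem Λ} (L : D.Limit A E)

theorem continuous_π (i : Λ) : Continuous (L.π i) :=
  (continuous_apply i).comp L.isInducing_alg.continuous

/-- The seminorm `a ↦ ‖π i a‖` on the inverse limit. -/
def seminorm (i : Λ) : ContCStarSeminorm A :=
  (normContCStarSeminorm (D.alg i)).pullback (L.π i) (L.continuous_π i)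

theorem withSeminorms_seminorm [IsTopologicalAddGroup A] :
    WithSeminorms fun i => (L.seminorm i).toSeminorm := by
  refine (SeminormFamily.withSeminorms_iff_nhds_eq_iInf _).2 ?_
  rw [L.isInducing_alg.nhds_eq_comap, nhds_pi, Filter.pi, Filter.comap_iInf]
  refine iInf_congr fun i => ?_
  rw [Filter.comap_comap, map_zero, ← comap_norm_nhds_zero (E := D.alg i), Filter.comap_comap]
  rfl

theorem seminorm_apply_le (hE : IsFull A E) (i : Λ) {α : A →⋆ₙₐ[ℂ] A} (hα : Continuous α)
    {u : E → E} (hu : IsCovariant α u) {v : D.mod i → D.mod i}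
    (hv : IsHilbertMorphism (D.alg i) (D.alg i) v) (huv : ∀ ξ, L.σ i (u ξ) = v (L.σ i ξ)) (a : A) :
    (L.seminorm i).toCStarSeminorm (α a) ≤ (L.seminorm i).toCStarSeminorm a := by
  obtain ⟨β, hβ, h⟩ := hv
  have hαβ : L.π i (α a) = β (L.π i a) :=
    hE.hom_ext (α := (L.π i).comp α) (β := β.comp (L.π i)) ((L.continuous_π i).comp hα)
      (hβ.comp (L.continuous_π i)) (fun ξ η => by
        change L.π i (α (inner A ξ η)) = β (L.π i (inner A ξ η))
        rw [← hu, ← L.inner_σ, ← L.inner_σ, huv, huv, h]) a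
  change ‖L.π i (α a)‖ ≤ ‖L.π i a‖
  rw [hαβ]
  exact NonUnitalStarAlgHom.norm_apply_le β _

end HilbertSystem.Limit

theorem IsInverseLimitAction.withSeminorms_invariant [IsTopologicalAddGroup A] (hE : IsFull A E)
    {u : HilbertAction A E G} (hu : IsInverseLimitAction u) {α : AlgAction G A}
    (hα : ∀ g ξ η, (α g).1 (inner A ξ η) = inner A ((u g).1 ξ) ((u g).1 η)) :
    WithSeminorms fun q : InvariantSeminorm fun g => ((α g).1 : A →⋆ₙₐ[ℂ] A) =>
      q.1.toSeminorm := by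
  obtain ⟨Λ, _, _, _, D, L, v, -, hv⟩ := hu
  have hle (i g a) : (L.seminorm i).toCStarSeminorm ((α g).1 a) ≤
      (L.seminorm i).toCStarSeminorm a :=
    L.seminorm_apply_le hE i (α := ((α g).1 : A →⋆ₙₐ[ℂ] A)) (α g).2.1
      (fun ξ η => (hα g ξ η).symm) (v i g).2.1 (hv i g) a
  have hinv (i g a) : (L.seminorm i).toCStarSeminorm ((α g).1 a) =
      (L.seminorm i).toCStarSeminorm a :=
    (hle i g a).antisymm <| by
      simpa only [AlgAction.apply_inv_apply_self] using hle i g⁻¹ ((α g).1 a)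
  exact withSeminorms_of_forall_exists_le_mul L.withSeminorms_seminorm
    (fun q => q.1.continuous_toFun) fun i =>
      ⟨⟨L.seminorm i, hinv i⟩, 1, fun a => (one_mul _).ge⟩

end InvariantGenerators

theorem isClosed_setOf_continuous_of_equicontinuous {G X Y : Type*} [TopologicalSpace G]
    [TopologicalSpace X] [UniformSpace Y] {v : G → X → Y} (hv : Equicontinuous v) :
    IsClosed {x | Continuous fun g => v g x} :=
  (UniformFun.isClosed_setOfPred_continuous G).preimage (equicontinuous_iff_continuous.1 hv)

namespace CompactOp

variable {A E G : Type*} [NonUnitalRing A] [StarRing A] [Module ℂ A] [UniformSpace A]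
  [IsLocallyCStarAlgebra A]
  [AddCommGroup E] [Module ℂ E] [SMul Aᵐᵒᵖ E] [Inner A E] [UniformSpace E] [IsHilbertModule A E]
  [Group G] {u : HilbertAction A E G} {α : AlgAction G A}
  (h : ∀ g ξ η, (α g).1 (inner A ξ η) = inner A ((u g).1 ξ) ((u g).1 η))

theorem knorm_inducedHom (q : InvariantSeminorm fun g => ((α g).1 : A →⋆ₙₐ[ℂ] A)) (g : G)
    (T : CompactOp A E E) : knorm q.1 (inducedHom u α h g T) = knorm q.1 T :=
  CovariantPerm.knorm_conjK (α := α g) _ _ (q.2 g) T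

theorem continuous_inducedAction_theta [TopologicalSpace G] (hu : IsContinuousAction u) (a : A)
    (ξ : E) : Continuous fun g => (inducedAction u α h g).1 (theta a ξ) := by
  simp only [inducedAction_theta]
  refine continuous_induced_rng.2 ?_
  refine (Adjointable.continuous_innerLeft.comp (hu (ξ <• star a))).congr fun g => ?_
  have hα : IsCovariant ((α g).1 : A →⋆ₙₐ[ℂ] A) (u g).1 := fun ξ η => (h g ξ η).symm
  change Adjointable.innerLeft ((u g).1 (ξ <• star a)) = Adjointable.theta _ _
  rw [Adjointable.theta_eq_innerLeft, hα.map_rsmul, map_star]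
  rfl

variable (hgen : WithSeminorms fun q : InvariantSeminorm fun g => ((α g).1 : A →⋆ₙₐ[ℂ] A) =>
  q.1.toSeminorm)

include hgen

theorem withSeminorms_invariant :
    WithSeminorms fun q : InvariantSeminorm (inducedHom u α h) => q.1.toSeminorm :=
  withSeminorms_of_forall_exists_le_mul (withSeminorms_of_monotone (Subtype.mono_coe _) hgen)
    (fun q => q.1.continuous_toFun) fun q =>
      ⟨⟨kCStarSeminorm E q.1, knorm_inducedHom h q⟩, 1, fun _ => (one_mul _).ge⟩

theorem isInverseLimitAction_inducedAction : IsInverseLimitAction (inducedAction u α h) :=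
  isInverseLimitAction_of_withSeminorms_invariant (withSeminorms_invariant h hgen)
    (isCovariant_inducedAction u α h)

theorem equicontinuous_inducedAction : Equicontinuous fun g => (inducedAction u α h g).1 := by
  have := IsHilbertModule.isUniformAddGroup (A := CompactOp A E E) (E := CompactOp A E A)
  have hK := IsHilbertModule.withSeminorms_of_monotone (E := CompactOp A E A)
    (Subtype.mono_coe _) (withSeminorms_invariant h hgen)
  have := hK.continuousSMul
  refine UniformEquicontinuous.equicontinuous ?_
  exact (hK.uniformEquicontinuous_iff_exists_continuous_seminorm
    fun g => (isCovariant_inducedAction u α h g).toLinearMap).2 fun q =>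
      ⟨_, hK.continuous_seminorm q, fun g T =>
        (isCovariant_inducedAction u α h g).modNorm_apply_le (fun S => (q.2 g S).le) T⟩

theorem isContinuousAction_inducedAction [TopologicalSpace G] (hu : IsContinuousAction u) :
    IsContinuousAction (inducedAction u α h) := by
  have := IsHilbertModule.continuousConstSMul (CompactOp A E E) (CompactOp A E A)
  let orbitContinuous : Submodule ℂ (CompactOp A E A) :=
    { carrier := {T | Continuous fun g => (inducedAction u α h g).1 T}
      zero_mem' := continuous_const.congr fun g =>
        (isCovariant_inducedAction u α h g).toLinearMap.map_zero.symm
      add_mem' := fun hS hT => (hS.add hT).congr fun g =>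
        ((isCovariant_inducedAction u α h g).map_add _ _).symm
      smul_mem' := fun c _ hT => (hT.const_smul c).congr fun g =>
        ((isCovariant_inducedAction u α h g).map_smul c _).symm }
  have hclosed : IsClosed (orbitContinuous : Set (CompactOp A E A)) :=
    isClosed_setOf_continuous_of_equicontinuous (equicontinuous_inducedAction h hgen)
  have hspan : Submodule.span ℂ {T : CompactOp A E A | ∃ a ξ, T = theta a ξ} ≤ orbitContinuous := by
    refine Submodule.span_le.2 ?_
    rintro _ ⟨a, ξ, rfl⟩
    exact continuous_inducedAction_theta h hu a ξ
  exact fun T => hclosed.closure_subset_iff.2 hspan (dense_span_theta T)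

end CompactOp

end

theorem proposition4p8_general {A E G : Type*}
    [NonUnitalRing A] [StarRing A] [Module ℂ A] [UniformSpace A] [IsLocallyCStarAlgebra A]
    [AddCommGroup E] [Module ℂ E] [SMul Aᵐᵒᵖ E] [Inner A E] [UniformSpace E]
    [IsHilbertModule A E] (hE : IsFull A E)
    [Group G] [TopologicalSpace G] (u : HilbertAction A E G) :
    IsLocallyCStarAlgebra (CompactOp A E E) ∧
    IsHilbertModule (CompactOp A E E) (CompactOp A E A) ∧
    ∃ α : AlgAction G A, (∀ g ξ η, (α g).1 (inner A ξ η) = inner A ((u g).1 ξ) ((u g).1 η)) ∧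
      (∀ α' : AlgAction G A,
        (∀ g ξ η, (α' g).1 (inner A ξ η) = inner A ((u g).1 ξ) ((u g).1 η)) → α' = α) ∧
      ∃ v : HilbertAction (CompactOp A E E) (CompactOp A E A) G,
        (∀ g (a : A) (ξ : E),
          (v g).1 (CompactOp.theta a ξ) = CompactOp.theta ((α g).1 a) ((u g).1 ξ)) ∧
        (∀ v' : HilbertAction (CompactOp A E E) (CompactOp A E A) G,
          (∀ g (a : A) (ξ : E),
            (v' g).1 (CompactOp.theta a ξ) = CompactOp.theta ((α g).1 a) ((u g).1 ξ)) → v' = v) ∧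
        (IsInverseLimitAction u → IsInverseLimitAction v) ∧
        (IsContinuousAction u → IsInverseLimitAction u → IsContinuousAction v) := by
  obtain ⟨α, hα, huniq⟩ := hE.exists_algAction u
  refine ⟨inferInstance, inferInstance, α, hα, huniq, CompactOp.inducedAction u α hα,
    CompactOp.inducedAction_theta u α hα, fun v' hv' => MonoidHom.ext fun g =>
      CompactOp.hilbertAut_ext fun a ξ =>
        (hv' g a ξ).trans (CompactOp.inducedAction_theta u α hα g a ξ).symm,
    fun hl => CompactOp.isInverseLimitAction_inducedAction hα (hl.withSeminorms_invariant hE hα),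
    fun hc hl =>
      CompactOp.isContinuousAction_inducedAction hα (hl.withSeminorms_invariant hE hα) hc⟩

theorem proposition4p8 {A E G : Type*}
    [NonUnitalRing A] [StarRing A] [Module ℂ A] [UniformSpace A] [IsLocallyCStarAlgebra A]
    [AddCommGroup E] [Module ℂ E] [SMul Aᵐᵒᵖ E] [Inner A E] [UniformSpace E]
    [IsHilbertModule A E] (hE : IsFull A E)
    [Group G] [TopologicalSpace G] [IsTopologicalGroup G] [LocallyCompactSpace G]
    (u : HilbertAction A E G) :
    -- `K(E)` is a locally C⋆-algebra and `K(E, A)` is a Hilbert `K(E)`-module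
    IsLocallyCStarAlgebra (CompactOp A E E) ∧
    IsHilbertModule (CompactOp A E E) (CompactOp A E A) ∧
    -- the action of `G` on `A` induced by `u`
    ∃ α : AlgAction G A, (∀ g ξ η, (α g).1 (inner A ξ η) = inner A ((u g).1 ξ) ((u g).1 η)) ∧
      (∀ α' : AlgAction G A,
        (∀ g ξ η, (α' g).1 (inner A ξ η) = inner A ((u g).1 ξ) ((u g).1 η)) → α' = α) ∧
      -- the action of `G` on `K(E, A)` induced by `u`
      ∃ v : HilbertAction (CompactOp A E E) (CompactOp A E A) G,
        (∀ g (a : A) (ξ : E),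
          (v g).1 (CompactOp.theta a ξ) = CompactOp.theta ((α g).1 a) ((u g).1 ξ)) ∧
        (∀ v' : HilbertAction (CompactOp A E E) (CompactOp A E A) G,
          (∀ g (a : A) (ξ : E),
            (v' g).1 (CompactOp.theta a ξ) = CompactOp.theta ((α g).1 a) ((u g).1 ξ)) → v' = v) ∧
        (IsContinuousAction u ∧ IsInverseLimitAction u →
          IsContinuousAction v ∧ IsInverseLimitAction v) := by
  obtain ⟨hK, hKA, α, hα, huniq, v, hv, hvuniq, hlim, hcont⟩ := proposition4p8_general hE u
  exact ⟨hK, hKA, α, hα, huniq, v, hv, hvuniq, fun ⟨hc, hl⟩ => ⟨hcont hc hl, hlim hl⟩⟩
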